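/- Let $k\ge 3$ and $d\ge 1$ be integers and put $q=\min\{k,d-1\}$. Let $P_k=\mathbb F_2[x_1,\dots,x_k]$ with $\deg x_i=1$, as a module over the mod-2 Steenrod algebra $\mathcal A$, so that $Sq^0$ is the identity, $Sq^1(x_i)=x_i^2$, $Sq^j(x_i)=0$ for $j\ge2$, and the Cartan formula holds. Let $\mathcal A^+P_k=\sum_{i\ge1}Sq^i(P_k)$. For a monomial $x$ in the variables $x_1,x_2,\dots$ let $\nu_j(x)$ be the exponent of $x_j$ in $x$, let $\alpha_i(a)$ be the coefficient of $2^i$ in the binary expansion of $a$, and for a monomial $x$ of $P_k$ let $\omega(x)=(\omega_1(x),\omega_2(x),\dots)$ with $\omega_i(x)=\sum_j\alpha_{i-1}(\nu_j(x))$ be its weight vector. Weight vectors are ordered left lexicographically, and $\deg\omega=\sum_{i\ge1}2^{i-1}\omega_i$. Let $P_k(\omega)$ (respectively $P_k^-(\omega)$) be the span of the monomials $y$ of $P_k$ with $\deg y=\deg\omega$ and $\omega(y)\le\omega$ (respectively $\omega(y)<\omega$), and let $$QP_k(\omega)=P_k(\omega)/\big((\mathcal A^+P_k\cap P_k(\omega))+P_k^-(\omega)\big);$$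 the class of $f\in P_k(\omega)$ is denoted by $[f]_\omega$. Let $\bar\omega_{(k,d)}=(k-1,\dots,k-1,k-3,1,0,0,\dots)$, where $k-1$ occurs $d-1$ times. Let $\mathcal N_{k,q}$ be the set of pairs $(i;I)$ with $I=(i_1,\dots,i_r)$, $1\le i<i_1<\dots<i_r\le k$ and $0\le r<q$. For such a pair let $f_i:P_{k-1}\to P_k$ be the algebra homomorphism with $f_i(x_j)=x_j$ for $j<i$ and $f_i(x_j)=x_{j+1}$ for $i\le j<k$. If $r>0$ and $1\le u\le r$, a monomial $x$ of $P_{k-1}$ is called $u$-compatible with $(i;I)$ if $\nu_{i_t-1}(x)=2^r-1$ for $1\le t<u$, $\nu_{i_u-1}(x)>2^r-1$, $\alpha_{r-t}(\nu_{i_u-1}(x))=1$ for $1\le t\le u$, and $\alpha_{r-t}(\nu_{i_t-1}(x))=1$ for $u<t\le r$; this holds for at most one $u$. Let $\phi_{(i;I)}:P_{k-1}\to P_k$ be the $\mathbb F_2$-linear map with $\phi_{(i;\emptyset)}=f_i$ and, for $r>0$ and a monomial $x$, $$\phi_{(i;I)}(x)=\frac{x_i^{2^r-1}f_i(x)}{x_{i_u}^{2^{r-1}+\dots+2^{r-u}}\prod_{u<t\le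 r}x_{i_t}^{2^{r-t}}}$$ if $x$ is $u$-compatible with $(i;I)$ for some $u$, and $\phi_{(i;I)}(x)=0$ otherwise. Let $X=x_1x_2\cdots x_{k-1}\in P_{k-1}$, and let $C_k$ be the set of the monomials $x_{j_1}x_{j_2}\cdots x_{j_{k-3}}x_j^2$ with $1\le j_1<\dots<j_{k-3}<k$ and $j_1\le j<k$ (so that $C_3=\emptyset$). Then for all $(i;I)\in\mathcal N_{k,q}$ and $z\in C_k$ the polynomial $\phi_{(i;I)}(X^{2^{d-1}-1}z^{2^{d-1}})$ lies in $P_k(\bar\omega_{(k,d)})$, and the family of classes $$\big[\phi_{(i;I)}(X^{2^{d-1}-1}z^{2^{d-1}})\big]_{\bar\omega_{(k,d)}},\qquad (i;I)\in\mathcal N_{k,q},\ z\in C_k,$$ is linearly independent in $QP_k(\bar\omega_{(k,d)})$. If $d>k$, this family is a basis of $QP_k(\bar\omega_{(k,d)})$. The space $QP_k(\bar\omega_{(k,d)})$ is finite-dimensional, $$\dim QP_k(\bar\omega_{(k,d)})\ \ge\ (k-3)\binom k2\sum_{u=1}^{q}\binom ku,$$ and equality holds if $d>k$. -/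

import Mathlib

namespace HitProblem

noncomputable section

/-- `P_k = 𝔽₂[x_1, …, x_k]`. The variable `x_{j+1}` is `MvPolynomial.X j` for `j : Fin k`. -/
abbrev P (k : ℕ) : Type := MvPolynomial (Fin k) (ZMod 2)

/-- The exponent vector `σ(x) = (ν_1(x), …, ν_k(x))` of a monomial `x` of `P_k`. -/
abbrev Mon (k : ℕ) : Type := Fin k →₀ ℕ

/-- The total Steenrod square `f ↦ ∑ i, Sq^i(f) T^i`: the algebra homomorphism
`P_k → P_k[T]` with `x_j ↦ x_j + x_j² T`. Multiplicativity is the Cartan formula. -/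
def totalSq (k : ℕ) : P k →ₐ[ZMod 2] Polynomial (P k) :=
  MvPolynomial.aeval fun j : Fin k =>
    Polynomial.C (MvPolynomial.X j) + Polynomial.C (MvPolynomial.X j ^ 2) * Polynomial.X

/-- The Steenrod square `Sq^i : P_k → P_k`. -/
def Sq (k i : ℕ) : P k →ₗ[ZMod 2] P k :=
  ((Polynomial.lcoeff (P k) i).restrictScalars (ZMod 2)).comp (totalSq k).toLinearMap

/-- The subspace `𝒜⁺P_k` of hit polynomials. Since `𝒜` is generated by the Steenrod squares,
`𝒜⁺ = ∑_{i ≥ 1} Sq^i 𝒜`, so `𝒜⁺P_k` is the sum of the images of the `Sq^i`, `i ≥ 1`. -/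
def hit (k : ℕ) : Submodule (ZMod 2) (P k) :=
  ⨆ (i : ℕ) (_ : 1 ≤ i), LinearMap.range (Sq k i)

/-- Weight vectors: sequences of natural numbers that are eventually zero.
The entry `ω_{i+1}` is `ω i`. -/
abbrev WeightVector : Type := ℕ →₀ ℕ

/-- The weight vector `ω(x)` of a monomial: `ω_{i+1}(x)` is the number of variables in whose
exponent the `i`-th binary digit is `1`. -/
def weight {k : ℕ} (x : Mon k) : WeightVector :=
  Finsupp.onFinset (Finset.range (∑ j, x j + 1)) (fun i => ∑ j, ((x j).testBit i).toNat) (by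
    intro i hi
    obtain ⟨j, -, hj⟩ := Finset.exists_ne_zero_of_sum_ne_zero hi
    have hb : (x j).testBit i = true := by
      by_contra h
      simp [h] at hj
    have h1 : 2 ^ i ≤ x j := Nat.ge_two_pow_of_testBit hb
    have h2 : i < 2 ^ i := Nat.lt_two_pow_self
    have h3 : x j ≤ ∑ j, x j := Finset.single_le_sum (fun _ _ => Nat.zero_le _) (Finset.mem_univ j)
    exact Finset.mem_range.2 (by omega))

/-- `deg ω = ∑_{i > 0} 2^{i-1} ω_i`. -/
def WeightVector.deg (ω : WeightVector) : ℕ := ω.sum fun i w => 2 ^ i * w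

/-- `P_k(ω)`: the span of the monomials `y` with `deg y = deg ω` and `ω(y) ≤ ω` in the left
lexicographic order. -/
def PW (k : ℕ) (ω : WeightVector) : Submodule (ZMod 2) (P k) :=
  Submodule.span (ZMod 2) {f | ∃ y : Mon k, y.degree = WeightVector.deg ω ∧
    toLex (weight y) ≤ toLex ω ∧ f = MvPolynomial.monomial y 1}

/-- `P_k^-(ω)`: the span of the monomials `y` of `P_k(ω)` with `ω(y) < ω`. -/
def PWminus (k : ℕ) (ω : WeightVector) : Submodule (ZMod 2) (P k) :=
  Submodule.span (ZMod 2) {f | ∃ y : Mon k, y.degree = WeightVector.deg ω ∧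
    toLex (weight y) < toLex ω ∧ f = MvPolynomial.monomial y 1}

/-- `QP_k(ω) = P_k(ω) / ((𝒜⁺P_k ∩ P_k(ω)) + P_k^-(ω))`. -/
abbrev QP (k : ℕ) (ω : WeightVector) : Type :=
  PW k ω ⧸ ((hit k ⊓ PW k ω) ⊔ PWminus k ω).comap (PW k ω).subtype

/-- The class `[f]_ω` in `QP_k(ω)` of a polynomial `f ∈ P_k(ω)`. -/
def cls {k : ℕ} {ω : WeightVector} (f : P k) (hf : f ∈ PW k ω) : QP k ω :=
  Submodule.Quotient.mk ⟨f, hf⟩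

/-- `𝒩_{k,h}`: the pairs `(i; I)` with `I = (i_1 < … < i_r)`, `i < i_1` and `r < h`.
The increasing tuple `I` is recorded by the set of its entries. -/
def N (k h : ℕ) : Set (Fin k × Finset (Fin k)) :=
  {p | (∀ j ∈ p.2, p.1 < j) ∧ p.2.card < h}

/-- The index map of `f_i`: it sends `j` to `j` if `j < i` and to `j + 1` if `i ≤ j`. -/
def skip {k : ℕ} (i : Fin k) (j : Fin (k - 1)) : Fin k :=
  if j.1 < i.1 then ⟨j.1, by omega⟩ else ⟨j.1 + 1, by omega⟩

/-- `f_i(x)` for a monomial `x` of `P_{k-1}`. -/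
def fMon {k : ℕ} (i : Fin k) (x : Mon (k - 1)) : Mon k := x.mapDomain (skip i)

/-- The entry `i_{t+1}` of the increasing tuple `I = (i_1, …, i_r)`, for `t : Fin r`. -/
def entry {k : ℕ} (I : Finset (Fin k)) (t : Fin I.card) : Fin k := I.orderEmbOfFin rfl t

/-- `ν_{i_{t+1}-1}(x)`: the exponent in the monomial `x` of `P_{k-1}` of the variable whose
index is one less than the entry `i_{t+1}` of `I`. It is used only when `i_{t+1}` is not the
first index (which holds whenever `i < i_1`); otherwise it is `0`. -/
def nuPred {k : ℕ} (x : Mon (k - 1)) (I : Finset (Fin k)) (t : Fin I.card) : ℕ :=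
  if h : 1 ≤ (entry I t).1 then x ⟨(entry I t).1 - 1, by omega⟩ else 0

/-- `x` is `(u+1)`-compatible with `(i; I)`, where `r = ℓ(I) > 0` and `u : Fin r`.
Positions in `I` are counted from `0`, so that `α_{r-t}` becomes the digit `r - 1 - t`. -/
def Compatible {k : ℕ} (x : Mon (k - 1)) (I : Finset (Fin k)) (u : Fin I.card) : Prop :=
  (∀ t, t < u → nuPred x I t = 2 ^ I.card - 1) ∧
  2 ^ I.card - 1 < nuPred x I u ∧
  (∀ t, t ≤ u → (nuPred x I u).testBit (I.card - 1 - t.1) = true) ∧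
  (∀ t, u < t → (nuPred x I t).testBit (I.card - 1 - t.1) = true)

/-- The monomial `x_{(I,u+1)} = x_{i_{u+1}}^{2^{r-1} + … + 2^{r-u-1}} ∏_{t > u+1} x_{i_t}^{2^{r-t}}`,
for `r = ℓ(I) > 0` and `u : Fin r`. -/
def xI {k : ℕ} (I : Finset (Fin k)) (u : Fin I.card) : Mon k :=
  Finsupp.single (entry I u) (∑ t ∈ Finset.Iic u, 2 ^ (I.card - 1 - t.1)) +
    ∑ t ∈ Finset.Ioi u, Finsupp.single (entry I t) (2 ^ (I.card - 1 - t.1))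

open Classical in
/-- `φ_{(i;I)}` on a monomial `x` of `P_{k-1}`: it is `f_i(x)` if `I = ∅`; if `I ≠ ∅`, it is
`(x_i^{2^r-1} f_i(x)) / x_{(I,u)}` when `x` is `u`-compatible with `(i; I)` (for the then unique
`u`; the division is exact, and is the subtraction of exponents), and `0` when there is no such
`u`. -/
def phiMon {k : ℕ} (i : Fin k) (I : Finset (Fin k)) (x : Mon (k - 1)) : P k :=
  if I = ∅ then MvPolynomial.monomial (fMon i x) 1
  else if h : ∃ u : Fin I.card, Compatible x I u then
    MvPolynomial.monomial
      ((Finsupp.single i (2 ^ I.card - 1) + fMon i x) - xI I h.choose) 1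
  else 0

/-- The `𝔽₂`-linear map `φ_{(i;I)} : P_{k-1} → P_k`. -/
def phi {k : ℕ} (i : Fin k) (I : Finset (Fin k)) : P (k - 1) →ₗ[ZMod 2] P k :=
  (MvPolynomial.basisMonomials (Fin (k - 1)) (ZMod 2)).constr (ZMod 2) (phiMon i I)

/-- `ω̄_{(k,d)} = ((k-1)^{(d-1)}, k-3, 1)`, for `k ≥ 3` and `d ≥ 1`. -/
def omegaBar (k d : ℕ) : WeightVector :=
  (List.replicate (d - 1) (k - 1) ++ [k - 3, 1]).toFinsupp

/-- `C_k`: the monomials `x_{j_1} ⋯ x_{j_{k-3}} x_j²` of `P_{k-1}` with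
`j_1 < … < j_{k-3} < k` and `j_1 ≤ j < k`. -/
def C (k : ℕ) : Set (Mon (k - 1)) :=
  {z | ∃ (J : Finset (Fin (k - 1))) (hJ : J.Nonempty) (j : Fin (k - 1)),
    J.card = k - 3 ∧ J.min' hJ ≤ j ∧
    z = (∑ s ∈ J, Finsupp.single s 1) + Finsupp.single j 2}

/-- The polynomial `φ_{(i;I)}(X^{2^{d-1}-1} z^{2^{d-1}})` with `X = x_1 x_2 ⋯ x_{k-1}`, for
`(i; I) ∈ 𝒩_{k,q}` and `z ∈ C_k`. -/
def gen (k d q : ℕ) (a : N k q × C k) : P k :=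
  phi a.1.1.1 a.1.1.2
    ((∏ j : Fin (k - 1), MvPolynomial.X j) ^ (2 ^ (d - 1) - 1) *
      (MvPolynomial.monomial (a.2 : Mon (k - 1)) 1) ^ 2 ^ (d - 1))

end

end HitProblem

/-!
Arrange the binary digits of the exponents of a monomial of `P_k` in rows, one for each power
of `2`. A monomial of weight `ω̄ = ((k-1)^{(d-1)}, k-3, 1)` is then a word `l` of length `d - 1`
(the letters are the variables missing from the first `d - 1` rows) followed by a monomial of weight
`(k-3, 1)`; it is obtained from the latter by `word l`, an iteration of `row A : f ↦ (∏_A x_j) f²`.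
Everything about Steenrod squares comes from the Cartan formula `Sq_row` for `Sq^i (row A f)`. In
particular a square of positive degree strictly lowers weights, and rows can be prepended to
congruences modulo hit polynomials and lower weights (`row_mem_hitLower`). The generator
`φ_{(i;I)}(X^{2^{d-1}-1} z^{2^{d-1}})` is `word l` of `f_i(z)`, where the set of letters of `l` is
`{i} ∪ I` (`gen_eq_word`).

*Linear independence.* For each `(i; I)` let `proj i I : P_k → P_{k-1}` be the linear substitution
with kernel generated by `x_i + ∑_{j ∈ I} x_j`. It commutes with the Steenrod squares, and so up
to halving of degrees does Kameko's down map `comp univ` on `P_{k-1}`. Their composite with `d - 1`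
down maps sends the word `l` followed by `f` to the projection of `f` if all letters of `l` lie in
`{i} ∪ I`, and to `0` otherwise (`pow_comp_univ_proj_word`). So the family is triangular with
respect to inclusion of the sets `{i} ∪ I`, and on the diagonal it remains to see that the elements
of `C_k` are independent in `QP_{k-1}((k-3, 1))`, where the only relations come from `Sq^1` of the
products of `k - 2` variables (`bottomRelations`, `linearIndependent_C`).

*Spanning for `d > k`.* The squares `Sq^1 (X^{2^e-1} f^{2^e})`, now with `X` the product of all `k`
variables, show that words may be permuted and that `aab` and `bba` are equivalent, so a word counts
only through its set `S` of letters (`word_congr_of_toFinset_eq`). They also give the relations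
`∑_{j ∈ F} (S ∪ {j}; F \ {j}; m) = 0` for sets `F` of four variables, where `(S; T; m)` is a word
with letters `S` followed by the product of the variables outside `T` and `x_m²`
(`sum_symbol_insert`; here `d > k` is needed to have words for all `S`). If `S` is read as the
function `∏_{j ∈ S} e_j` on `𝔽₂^k`, with `e_j` the coordinate functions, then passing to indicator
functions of points decouples the relations: for each nonzero point one is left with a copy of
`QP_{k-1}((k-3, 1))` (`sum_pointSymbol_row`, `mem_of_relations`). There are `2^k - 1` such points,
which are as many as the pairs `(i; I)`, so the dimension is at most the number of generators
(`finrank_QP_le`).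
-/

namespace HitProblem

open MvPolynomial Finset

/-! ### Row decomposition of polynomials -/

/-- The squarefree monomial `∏_{j ∈ A} x_j`. -/
noncomputable def sqfree {k : ℕ} (A : Finset (Fin k)) : P k := ∏ j ∈ A, X j

/-- The map `f ↦ (∏_{j ∈ A} x_j) f²`, which is linear over `𝔽₂`. If the binary digits of the
exponents of a monomial are arranged in rows, one for each power of `2`, it prepends the row that
is the indicator of `A`. -/
noncomputable def row {k : ℕ} (A : Finset (Fin k)) : P k →ₗ[ZMod 2] P k where
  toFun f := sqfree A * f ^ 2
  map_add' f g := by rw [CharTwo.add_sq, mul_add]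
  map_smul' c f := by
    have hc : c ^ 2 = c := by revert c; decide
    rw [smul_pow, hc, RingHom.id_apply, mul_smul_comm]

/-- The exponent vector with lowest binary digits the indicator of `A` and higher digits those
of `y`. -/
noncomputable def cons {k : ℕ} (A : Finset (Fin k)) (y : Mon k) : Mon k :=
  Finsupp.equivFunOnFinite.symm fun j => (if j ∈ A then 1 else 0) + 2 * y j

/-- The variables of odd exponent. -/
def oddSet {k : ℕ} (y : Mon k) : Finset (Fin k) := univ.filter fun j => y j % 2 = 1

/-- The exponent vector with the lowest binary digits removed. -/
noncomputable def half {k : ℕ} (y : Mon k) : Mon k :=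
  Finsupp.equivFunOnFinite.symm fun j => y j / 2

/-- The component `f_A` in the unique decomposition `f = ∑_A (∏_{j ∈ A} x_j) f_A²`. For `A` the
set of all variables this is Kameko's down map. -/
noncomputable def comp {k : ℕ} (A : Finset (Fin k)) : P k →ₗ[ZMod 2] P k :=
  (basisMonomials (Fin k) (ZMod 2)).constr (ZMod 2) fun x =>
    if oddSet x = A then monomial (half x) 1 else 0

section Rows

variable {k : ℕ}

theorem row_apply (A : Finset (Fin k)) (f : P k) : row A f = sqfree A * f ^ 2 := rfl

theorem cons_apply (A : Finset (Fin k)) (y : Mon k) (j : Fin k) :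
    cons A y j = (if j ∈ A then 1 else 0) + 2 * y j := rfl

theorem cons_oddSet_half (y : Mon k) : cons (oddSet y) (half y) = y := by
  ext j
  simp only [cons_apply, oddSet, half, mem_filter, mem_univ, true_and,
    Finsupp.equivFunOnFinite_symm_apply_apply]
  split_ifs <;> omega

theorem oddSet_cons (A : Finset (Fin k)) (y : Mon k) : oddSet (cons A y) = A := by
  ext j
  rw [oddSet, mem_filter, cons_apply]
  by_cases h : j ∈ A <;> simp [h]

theorem half_cons (A : Finset (Fin k)) (y : Mon k) : half (cons A y) = y := by
  ext j
  simp only [half, cons_apply, Finsupp.equivFunOnFinite_symm_apply_apply]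
  split_ifs <;> omega

theorem cons_injective {A B : Finset (Fin k)} {x y : Mon k} (h : cons A x = cons B y) :
    A = B ∧ x = y :=
  ⟨by rw [← oddSet_cons A x, h, oddSet_cons], by rw [← half_cons A x, h, half_cons]⟩

theorem sqfree_eq_monomial (A : Finset (Fin k)) : sqfree A = monomial (cons A 0) 1 := by
  have h : cons A 0 = ∑ j ∈ A, Finsupp.single j 1 := by
    ext j
    rw [Finsupp.finsetSum_apply]
    simp [cons_apply, Finsupp.single_apply]
  rw [h, monomial_sum_one]
  rfl

theorem row_monomial (A : Finset (Fin k)) (y : Mon k) :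
    row A (monomial y 1) = monomial (cons A y) 1 := by
  have h : cons A 0 + 2 • y = cons A y := by
    ext j
    simp [cons_apply]
  rw [row_apply, sqfree_eq_monomial, monomial_pow, monomial_mul, one_pow, one_mul, h]

theorem monomial_eq_row (y : Mon k) :
    (monomial y 1 : P k) = row (oddSet y) (monomial (half y) 1) := by
  rw [row_monomial, cons_oddSet_half]

theorem monomial_induction {motive : P k → Prop} (f : P k) (zero : motive 0)
    (monomial : ∀ y, motive (monomial y 1)) (add : ∀ f g, motive f → motive g → motive (f + g)) :
    motive f := by
  induction f using MvPolynomial.induction_on' with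
  | monomial y a =>
    have ha : a = 0 ∨ a = 1 := by revert a; decide
    rcases ha with rfl | rfl
    · simpa using zero
    · exact monomial y
  | add p q hp hq => exact add p q hp hq

/-- To prove an additive property of all polynomials it is enough to treat the polynomials
`row A f`. -/
theorem row_induction {motive : P k → Prop} (f : P k) (row : ∀ A f, motive (row A f))
    (add : ∀ f g, motive f → motive g → motive (f + g)) : motive f := by
  refine monomial_induction f ?_ (fun y => ?_) add
  · simpa using row ∅ 0
  · rw [monomial_eq_row]
    exact row _ _

theorem comp_monomial (A : Finset (Fin k)) (y : Mon k) :
    comp A (monomial y 1) = if oddSet y = A then monomial (half y) 1 else 0 := by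
  have h := (basisMonomials (Fin k) (ZMod 2)).constr_basis (ZMod 2)
    (fun x => if oddSet x = A then (monomial (half x) 1 : P k) else 0) y
  rw [coe_basisMonomials] at h
  exact h

theorem comp_row (A B : Finset (Fin k)) (f : P k) :
    comp A (row B f) = if B = A then f else 0 := by
  induction f using monomial_induction with
  | zero => simp
  | monomial y => rw [row_monomial, comp_monomial, oddSet_cons, half_cons]
  | add f g hf hg =>
    rw [map_add, map_add, hf, hg]
    split_ifs <;> simp

theorem comp_mul_sq (A : Finset (Fin k)) (h g : P k) : comp A (h * g ^ 2) = comp A h * g := by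
  induction h using row_induction with
  | row B f =>
    have hr : row B f * g ^ 2 = row B (f * g) := by rw [row_apply, row_apply, mul_pow, mul_assoc]
    rw [hr, comp_row, comp_row]
    split_ifs <;> simp
  | add h h' ih ih' => rw [add_mul, map_add, map_add, ih, ih', add_mul]

theorem coeff_comp (A : Finset (Fin k)) (f : P k) (y : Mon k) :
    coeff y (comp A f) = coeff (cons A y) f := by
  induction f using monomial_induction with
  | zero => simp
  | monomial x =>
    rw [← cons_oddSet_half x, comp_monomial, oddSet_cons, half_cons, coeff_monomial]
    by_cases hA : oddSet x = A
    · subst hA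
      rw [if_pos rfl, coeff_monomial]
      by_cases hy : half x = y
      · subst hy; simp
      · rw [if_neg hy, if_neg fun h => hy (cons_injective h).2]
    · rw [if_neg hA, coeff_zero, if_neg fun h => hA (cons_injective h).1]
  | add f g hf hg => rw [map_add, coeff_add, coeff_add, hf, hg]

theorem sqfree_insert {A : Finset (Fin k)} {j : Fin k} (hj : j ∉ A) :
    sqfree (insert j A) = X j * sqfree A := prod_insert hj

theorem sqfree_erase {A : Finset (Fin k)} {j : Fin k} (hj : j ∈ A) :
    X j * sqfree (A.erase j) = sqfree A := mul_prod_erase A _ hj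

theorem X_mul_row_of_notMem {A : Finset (Fin k)} {j : Fin k} (hj : j ∉ A) (f : P k) :
    X j * row A f = row (insert j A) f := by
  rw [row_apply, row_apply, sqfree_insert hj, mul_assoc]

theorem X_mul_row_of_mem {A : Finset (Fin k)} {j : Fin k} (hj : j ∈ A) (f : P k) :
    X j * row A f = row (A.erase j) (X j * f) := by
  rw [row_apply, row_apply, ← sqfree_erase hj]
  ring

/-! ### Weight vectors -/

theorem weight_cons_zero (A : Finset (Fin k)) (y : Mon k) : weight (cons A y) 0 = #A := by
  change ∑ j, ((cons A y j).testBit 0).toNat = #A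
  rw [card_eq_sum_ones, ← sum_filter_add_sum_filter_not univ (· ∈ A), filter_mem_eq_inter,
    univ_inter, sum_eq_zero (s := filter _ _), add_zero]
  · refine sum_congr rfl fun j hj => ?_
    simp [cons_apply, hj]
  · intro j hj
    simp [cons_apply, (mem_filter.1 hj).2]

theorem weight_cons_succ (A : Finset (Fin k)) (y : Mon k) (i : ℕ) :
    weight (cons A y) (i + 1) = weight y i := by
  change ∑ j, ((cons A y j).testBit (i + 1)).toNat = ∑ j, ((y j).testBit i).toNat
  refine sum_congr rfl fun j _ => ?_
  rw [Nat.testBit_succ, cons_apply]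
  congr 3
  split_ifs <;> omega

theorem weight_zero : weight (0 : Mon k) = 0 := by
  ext i
  change ∑ j : Fin k, ((0 : ℕ).testBit i).toNat = 0
  simp

end Rows

/-- The sequence `(c, ω_1, ω_2, …)`. -/
def consWeight (c : ℕ) (ω : ℕ → ℕ) : ℕ → ℕ
  | 0 => c
  | i + 1 => ω i

/-- The strict left lexicographic order on sequences. -/
def LexLT (a b : ℕ → ℕ) : Prop := ∃ i, (∀ j < i, a j = b j) ∧ a i < b i

/-- The span of all monomials of weight less than `ω`, of any degree. -/
noncomputable def lower (k : ℕ) (ω : ℕ → ℕ) : Submodule (ZMod 2) (P k) :=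
  Submodule.span (ZMod 2) {f | ∃ y : Mon k, LexLT (weight y) ω ∧ f = monomial y 1}

/-- The polynomials that are hit modulo monomials of weight less than `ω`. -/
noncomputable def hitLower (k : ℕ) (ω : ℕ → ℕ) : Submodule (ZMod 2) (P k) := hit k ⊔ lower k ω

section Weights

variable {k : ℕ}

theorem lexLT_consWeight {a b : ℕ → ℕ} {c e : ℕ} :
    LexLT (consWeight c a) (consWeight e b) ↔ c < e ∨ c = e ∧ LexLT a b := by
  constructor
  · rintro ⟨i, h1, h2⟩
    cases i with
    | zero => exact Or.inl h2
    | succ i => exact Or.inr ⟨h1 0 i.succ_pos, i, fun j hj => h1 (j + 1) (by omega), h2⟩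
  · rintro (h | ⟨rfl, i, h1, h2⟩)
    · exact ⟨0, by simp, h⟩
    · refine ⟨i + 1, fun j hj => ?_, h2⟩
      cases j with
      | zero => rfl
      | succ j => exact h1 j (by omega)

theorem weight_cons (A : Finset (Fin k)) (y : Mon k) :
    (weight (cons A y) : ℕ → ℕ) = consWeight #A (weight y) := by
  funext i
  cases i with
  | zero => exact weight_cons_zero A y
  | succ i => exact weight_cons_succ A y i

theorem row_mem_lower_of_card_lt {A : Finset (Fin k)} {ω : ℕ → ℕ} (h : #A < ω 0) (f : P k) :
    row A f ∈ lower k ω := by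
  induction f using monomial_induction with
  | zero => simp
  | monomial y =>
    rw [row_monomial]
    refine Submodule.subset_span ⟨_, ⟨0, by simp, ?_⟩, rfl⟩
    rwa [weight_cons_zero]
  | add f g hf hg => rw [map_add]; exact add_mem hf hg

theorem row_mem_lower {A : Finset (Fin k)} {ω : ℕ → ℕ} {f : P k} (hf : f ∈ lower k ω) :
    row A f ∈ lower k (consWeight #A ω) := by
  induction hf using Submodule.span_induction with
  | mem f hf =>
    obtain ⟨y, hy, rfl⟩ := hf
    rw [row_monomial]
    refine Submodule.subset_span ⟨_, ?_, rfl⟩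
    rw [weight_cons]
    exact lexLT_consWeight.2 (Or.inr ⟨rfl, hy⟩)
  | zero => simp
  | add f g _ _ hf hg => rw [map_add]; exact add_mem hf hg
  | smul c f _ hf => rw [map_smul]; exact Submodule.smul_mem _ _ hf

end Weights

/-! ### Steenrod squares of rows -/

section Squares

variable {k : ℕ}

theorem totalSq_X (j : Fin k) :
    totalSq k (X j) = Polynomial.C (X j) + Polynomial.C (X j ^ 2) * Polynomial.X := by
  simp [totalSq]

theorem Sq_apply (i : ℕ) (f : P k) : Sq k i f = (totalSq k f).coeff i := rfl

theorem Sq_mem_hit {i : ℕ} (hi : 1 ≤ i) (f : P k) : Sq k i f ∈ hit k :=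
  Submodule.mem_iSup_of_mem i (Submodule.mem_iSup_of_mem hi ⟨f, rfl⟩)

theorem hit_le {S : Submodule (ZMod 2) (P k)} (h : ∀ i, 1 ≤ i → ∀ f, Sq k i f ∈ S) :
    hit k ≤ S := by
  refine iSup_le fun i => iSup_le fun hi => ?_
  rintro _ ⟨f, rfl⟩
  exact h i hi f

theorem totalSq_sqfree (A : Finset (Fin k)) : totalSq k (sqfree A) =
    ∑ B ∈ A.powerset, Polynomial.C (sqfree (A \ B) * sqfree B ^ 2) * Polynomial.X ^ #B := by
  rw [sqfree, map_prod]
  simp_rw [totalSq_X, add_comm (Polynomial.C (X _))]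
  rw [prod_add]
  refine sum_congr rfl fun B _ => ?_
  rw [prod_mul_distrib, prod_const, ← map_prod, ← map_prod, prod_pow, map_mul]
  simp only [sqfree, map_prod, map_pow]
  ring

theorem coeff_totalSq_sq (f : P k) (i : ℕ) :
    (totalSq k (f ^ 2)).coeff i = if Even i then Sq k (i / 2) f ^ 2 else 0 := by
  rw [map_pow, ← Polynomial.map_frobenius_expand 2, Polynomial.coeff_map,
    Polynomial.coeff_expand two_pos]
  by_cases h : 2 ∣ i
  · rw [if_pos h, if_pos (even_iff_two_dvd.2 h)]
    rfl
  · rw [if_neg h, if_neg (mt even_iff_two_dvd.1 h), map_zero]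

/-- The Cartan formula for `(∏_{j ∈ A} x_j) f²`. -/
theorem Sq_row (A : Finset (Fin k)) (f : P k) (i : ℕ) : Sq k i (row A f) =
    ∑ B ∈ A.powerset, if #B ≤ i ∧ Even (i - #B) then
      row (A \ B) (sqfree B * Sq k ((i - #B) / 2) f) else 0 := by
  rw [Sq_apply, row_apply, map_mul, totalSq_sqfree, sum_mul, Polynomial.finsetSum_coeff]
  refine sum_congr rfl fun B _ => ?_
  rw [mul_assoc, Polynomial.coeff_C_mul, mul_comm (Polynomial.X ^ _),
    Polynomial.coeff_mul_X_pow', coeff_totalSq_sq]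
  by_cases h1 : #B ≤ i
  · by_cases h2 : Even (i - #B)
    · rw [if_pos h1, if_pos h2, if_pos ⟨h1, h2⟩, row_apply]
      ring
    · simp [h2]
  · simp [h1]

theorem Sq_zero (f : P k) : Sq k 0 f = f := by
  have h : (Polynomial.constantCoeff (R := P k)).comp (totalSq k : P k →+* _) = RingHom.id _ := by
    apply MvPolynomial.ringHom_ext
    · intro r
      simp [totalSq]
    · intro j
      simp [totalSq_X]
  exact congrArg (fun φ : P k →+* P k => φ f) h

theorem Sq_one_row (A : Finset (Fin k)) (f : P k) :
    Sq k 1 (row A f) = ∑ j ∈ A, row (A.erase j) (X j * f) := by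
  have h1 : ∀ B ∈ A.powerset, (#B ≤ 1 ∧ Even (1 - #B)) ↔ #B = 1 := by
    intro B _
    constructor
    · rintro ⟨h, he⟩
      rcases Nat.le_one_iff_eq_zero_or_eq_one.1 h with h0 | h0
      · simp [h0] at he
      · exact h0
    · intro h
      simp [h]
  rw [Sq_row, ← sum_filter, filter_congr h1, ← powersetCard_eq_filter, powersetCard_one, sum_map]
  refine sum_congr rfl fun j _ => ?_
  simp [sqfree, Sq_zero, sdiff_singleton_eq_erase]

/-- Up to monomials of lower weight, `Sq^{2i}((∏_{j ∈ A} x_j) g²) = (∏_{j ∈ A} x_j) (Sq^i g)²`,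
so prepending a row preserves polynomials that are hit modulo lower weight. -/
theorem row_mem_hitLower {A : Finset (Fin k)} {ω : ℕ → ℕ} {f : P k} (hf : f ∈ hitLower k ω) :
    row A f ∈ hitLower k (consWeight #A ω) := by
  have h : hitLower k ω ≤ (hitLower k (consWeight #A ω)).comap (row A) := by
    refine sup_le (hit_le fun i hi g => ?_) fun g hg => ?_
    · have h2 := Sq_row A g (2 * i)
      rw [← add_sum_erase _ _ (empty_mem_powerset A)] at h2
      have h3 : row A (Sq k i g) = Sq k (2 * i) (row A g) -
          ∑ B ∈ A.powerset.erase ∅, if #B ≤ 2 * i ∧ Even (2 * i - #B) then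
            row (A \ B) (sqfree B * Sq k ((2 * i - #B) / 2) g) else 0 := by
        rw [h2, add_sub_cancel_right]
        simp [sqfree]
      rw [Submodule.mem_comap, h3]
      refine sub_mem (Submodule.mem_sup_left (Sq_mem_hit (by omega) _))
        (Submodule.mem_sup_right (sum_mem fun B hB => ?_))
      split_ifs
      · refine row_mem_lower_of_card_lt ?_ _
        obtain ⟨hB0, hBA⟩ := mem_erase.1 hB
        exact card_lt_card (sdiff_ssubset (mem_powerset.1 hBA) (nonempty_iff_ne_empty.2 hB0))
      · exact zero_mem _
    · exact Submodule.mem_sup_right (row_mem_lower hg)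
  exact h hf

end Squares

/-! ### The bottom weight: coefficients and hit polynomials -/

section Coefficients

variable {k : ℕ}

theorem cons_singleton_zero (m : Fin k) : cons {m} (0 : Mon k) = Finsupp.single m 1 := by
  ext j
  simp [cons_apply, Finsupp.single_apply, eq_comm]

theorem coeff_single_eq_constantCoeff_comp (m : Fin k) (f : P k) :
    coeff (Finsupp.single m 1) f = constantCoeff (comp {m} f) := by
  rw [constantCoeff_eq, coeff_comp, cons_singleton_zero]

theorem constantCoeff_sqfree_mul {B : Finset (Fin k)} (hB : B.Nonempty) (f : P k) :
    constantCoeff (sqfree B * f) = 0 := by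
  obtain ⟨j, hj⟩ := hB
  rw [← sqfree_erase hj]
  simp

theorem coeff_single_sqfree_mul {B : Finset (Fin k)} {m : Fin k} (h0 : B ≠ ∅) (h1 : B ≠ {m})
    (f : P k) : coeff (Finsupp.single m 1) (sqfree B * f) = 0 := by
  obtain ⟨j, hj, hjm⟩ : ∃ j ∈ B, j ≠ m := by
    by_contra! h
    exact (Finset.subset_singleton_iff.1 fun j hj => mem_singleton.2 (h j hj)).elim h0 h1
  rw [← sqfree_erase hj, mul_assoc, coeff_X_mul', if_neg]
  rw [Finsupp.support_single _ one_ne_zero, mem_singleton]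
  exact hjm

theorem constantCoeff_Sq {i : ℕ} (hi : 1 ≤ i) (f : P k) : constantCoeff (Sq k i f) = 0 := by
  have h : (Polynomial.mapRingHom (constantCoeff (σ := Fin k) (R := ZMod 2))).comp
      (totalSq k : P k →+* _) = Polynomial.C.comp constantCoeff := by
    apply MvPolynomial.ringHom_ext
    · intro r
      simp [totalSq]
    · intro j
      simp [totalSq_X]
  have h2 := congrArg (fun φ : P k →+* Polynomial (ZMod 2) => (φ f).coeff i) h
  simp only [RingHom.comp_apply, Polynomial.coe_mapRingHom, Polynomial.coeff_map,
    Polynomial.coeff_C, RingHom.coe_coe, if_neg (by omega : i ≠ 0)] at h2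
  exact h2

theorem coeff_single_Sq {i : ℕ} (hi : 1 ≤ i) (m : Fin k) (f : P k) :
    coeff (Finsupp.single m 1) (Sq k i f) = 0 := by
  rw [coeff_single_eq_constantCoeff_comp]
  induction f using row_induction with
  | row A f =>
    rw [Sq_row, map_sum, map_sum]
    refine sum_eq_zero fun B _ => ?_
    split_ifs with h
    · rw [comp_row]
      split_ifs
      · rcases B.eq_empty_or_nonempty with rfl | hB
        · obtain ⟨c, hc⟩ := h.2
          rw [card_empty] at hc ⊢
          rw [map_mul, constantCoeff_Sq (by omega), mul_zero]
        · exact constantCoeff_sqfree_mul hB _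
      · simp
    · simp
  | add f g hf hg => rw [map_add, map_add, map_add, hf, hg, add_zero]

/-- The coefficient of the monomial `(∏_{j ∈ J} x_j) x_m²`. -/
noncomputable def bottomCoeff (J : Finset (Fin k)) (m : Fin k) : P k →ₗ[ZMod 2] ZMod 2 :=
  (lcoeff (ZMod 2) (Finsupp.single m 1)).comp (comp J)

theorem bottomCoeff_apply (J : Finset (Fin k)) (m : Fin k) (f : P k) :
    bottomCoeff J m f = coeff (Finsupp.single m 1) (comp J f) := rfl

theorem bottomCoeff_Sq_row {i : ℕ} (hi : 1 ≤ i) (A J : Finset (Fin k)) (m : Fin k) (f : P k) :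
    bottomCoeff J m (Sq k i (row A f)) =
      if m ∉ J ∧ A = insert m J ∧ Odd i then constantCoeff (Sq k ((i - 1) / 2) f) else 0 := by
  rw [Sq_row, map_sum]
  have hterm : ∀ B ∈ A.powerset, B ≠ {m} →
      bottomCoeff J m (if #B ≤ i ∧ Even (i - #B) then
        row (A \ B) (sqfree B * Sq k ((i - #B) / 2) f) else 0) = 0 := by
    intro B _ hBm
    split_ifs with h
    · rw [bottomCoeff_apply, comp_row]
      split_ifs
      · by_cases hB : B = ∅
        · subst hB
          obtain ⟨c, hc⟩ := h.2
          rw [card_empty] at hc ⊢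
          have := coeff_single_Sq (i := (i - 0) / 2) (by omega) m f
          simpa [sqfree] using this
        · exact coeff_single_sqfree_mul hB hBm _
      · simp
    · simp
  by_cases hm : m ∈ A
  · rw [sum_eq_single_of_mem {m} (by simpa using hm) hterm, card_singleton,
      apply_ite (bottomCoeff J m), map_zero, bottomCoeff_apply, comp_row]
    have hodd : (1 ≤ i ∧ Even (i - 1)) ↔ Odd i := by
      rw [and_iff_right hi]
      rcases Nat.even_or_odd i with h | h
      · simp [Nat.even_sub hi, Nat.odd_iff, Nat.even_iff]
      · simp [Nat.even_sub hi, Nat.odd_iff, Nat.even_iff]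
    have hJ : A \ {m} = J ↔ m ∉ J ∧ A = insert m J := by
      constructor
      · rintro rfl
        refine ⟨by simp, ?_⟩
        rw [sdiff_singleton_eq_erase, insert_erase hm]
      · rintro ⟨h, rfl⟩
        rw [sdiff_singleton_eq_erase, erase_insert h]
    by_cases h1 : Odd i
    · by_cases h2 : A \ {m} = J
      · rw [if_pos (hodd.2 h1), if_pos h2, if_pos ⟨(hJ.1 h2).1, (hJ.1 h2).2, h1⟩]
        simp [sqfree, coeff_X_mul', constantCoeff_eq]
      · rw [if_pos (hodd.2 h1), if_neg h2, if_neg fun h => h2 (hJ.2 ⟨h.1, h.2.1⟩), coeff_zero]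
    · rw [if_neg (mt hodd.1 h1), if_neg fun h => h1 h.2.2]
  · rw [if_neg fun h => hm (by rw [h.2.1]; exact mem_insert_self _ _)]
    refine sum_eq_zero fun B hB => hterm B hB ?_
    rintro rfl
    exact hm (by simpa using hB)

/-- The polynomials of `P_n` whose coefficients at the monomials `(∏_{j ∈ J} x_j) x_m²` of weight
`(n-2, 1)` vanish for `m ∈ J`, and for `J` the complement of `{b, m}` depend on `b` only. They
contain all hit polynomials, as `Sq^1` of the product of all variables but `x_b` is the sum of
`(∏_{j ≠ b, m} x_j) x_m²` over `m ≠ b`. -/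
noncomputable def bottomRelations (n : ℕ) : Submodule (ZMod 2) (P n) where
  carrier := {f | (∀ J m, #J + 2 = n → m ∈ J → bottomCoeff J m f = 0) ∧
    ∀ b m m', b ≠ m → b ≠ m' → bottomCoeff {b, m}ᶜ m f = bottomCoeff {b, m'}ᶜ m' f}
  add_mem' hf hg := ⟨fun J m hJ hm => by rw [map_add, hf.1 J m hJ hm, hg.1 J m hJ hm, add_zero],
    fun b m m' h h' => by rw [map_add, map_add, hf.2 b m m' h h', hg.2 b m m' h h']⟩
  zero_mem' := by simp
  smul_mem' c f hf := ⟨fun J m hJ hm => by rw [map_smul, hf.1 J m hJ hm, smul_zero],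
    fun b m m' h h' => by rw [map_smul, map_smul, hf.2 b m m' h h']⟩

theorem insert_compl_pair {b m : Fin k} (h : b ≠ m) :
    insert m ({b, m} : Finset (Fin k))ᶜ = {b}ᶜ := by
  ext j
  simp only [mem_insert, mem_compl, mem_singleton]
  grind

theorem hit_le_bottomRelations (n : ℕ) : hit n ≤ bottomRelations n := by
  refine hit_le fun i hi f => ?_
  induction f using row_induction with
  | row A f =>
    refine ⟨fun J m _ hm => ?_, fun b m m' h h' => ?_⟩
    · rw [bottomCoeff_Sq_row hi, if_neg fun h => h.1 hm]
    · rw [bottomCoeff_Sq_row hi, bottomCoeff_Sq_row hi, insert_compl_pair h, insert_compl_pair h']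
      simp
  | add f g hf hg => rw [map_add]; exact add_mem hf hg

theorem mem_bottomRelations_of_forall {n : ℕ} {f : P n}
    (h : ∀ J m, #J + 2 = n → bottomCoeff J m f = 0) : f ∈ bottomRelations n := by
  have hc : ∀ b m : Fin n, b ≠ m → #({b, m} : Finset (Fin n))ᶜ + 2 = n := by
    intro b m hbm
    have := card_le_univ ({b, m} : Finset (Fin n))
    rw [card_compl, card_pair hbm, Fintype.card_fin] at *
    omega
  exact ⟨fun J m hJ _ => h J m hJ, fun b m m' hb hb' => by
    rw [h _ _ (hc b m hb), h _ _ (hc b m' hb')]⟩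

/-! ### Kameko's down map -/

theorem comp_univ_mem_hit {f : P k} (hf : f ∈ hit k) : comp univ f ∈ hit k := by
  have h : hit k ≤ (hit k).comap (comp univ) := by
    refine hit_le fun i hi g => ?_
    rw [Submodule.mem_comap]
    induction g using row_induction with
    | row A g =>
      rw [Sq_row, map_sum]
      refine sum_mem fun B hB => ?_
      split_ifs with h
      · rw [comp_row]
        split_ifs with hAB
        · have hB0 : B = ∅ := by
            refine Finset.eq_empty_of_forall_notMem fun j hj => ?_
            have := mem_univ j
            rw [← hAB] at this
            exact (mem_sdiff.1 this).2 hj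
          subst hB0
          obtain ⟨c, hc⟩ := h.2
          rw [card_empty] at hc ⊢
          have := Sq_mem_hit (i := (i - 0) / 2) (by omega) g
          simpa [sqfree] using this
        · exact zero_mem _
      · simp
    | add f g hf hg => rw [map_add, map_add]; exact add_mem hf hg
  exact h hf

end Coefficients

/-! ### Linear projections `P_k → P_{k-1}` -/

section Skip

variable {k : ℕ}

theorem skip_injective (i : Fin k) : Function.Injective (skip i) := by
  intro a b h
  simp only [skip] at h
  ext
  split_ifs at h <;> simp only [Fin.mk.injEq] at h <;> omega

theorem skip_ne (i : Fin k) (s : Fin (k - 1)) : skip i s ≠ i := by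
  intro h
  have h2 := congrArg Fin.val h
  simp only [skip] at h2
  split_ifs at h2 <;> simp only at h2 <;> omega

theorem exists_skip_eq {i j : Fin k} (h : j ≠ i) : ∃ s, skip i s = j := by
  have h' : j.1 ≠ i.1 := fun e => h (Fin.ext e)
  rcases lt_or_gt_of_ne h' with h1 | h1
  · exact ⟨⟨j.1, by omega⟩, by simp [skip, h1]⟩
  · refine ⟨⟨j.1 - 1, by omega⟩, ?_⟩
    have h2 : ¬ j.1 - 1 < i.1 := by omega
    ext
    simp only [skip, if_neg h2]
    omega

end Skip

/-- The algebra homomorphism `P_k → P_{k-1}` whose kernel is generated by the linear form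
`x_i + ∑_{j ∈ I} x_j`: it is left inverse to `f_i` and sends `x_i` to the sum of the variables
that `f_i` maps to the `x_j` with `j ∈ I`. -/
noncomputable def proj {k : ℕ} (i : Fin k) (I : Finset (Fin k)) : P k →ₐ[ZMod 2] P (k - 1) :=
  aeval fun j => ∑ s with skip i s = j ∨ j = i ∧ skip i s ∈ I, X s

section Proj

variable {k : ℕ}

theorem proj_X (i : Fin k) (I : Finset (Fin k)) (j : Fin k) :
    proj i I (X j) = ∑ s with skip i s = j ∨ j = i ∧ skip i s ∈ I, X s := by
  rw [proj, aeval_X]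

theorem proj_X_skip (i : Fin k) (I : Finset (Fin k)) (s : Fin (k - 1)) :
    proj i I (X (skip i s)) = X s := by
  rw [proj_X]
  have h : (univ.filter fun s' => skip i s' = skip i s ∨ skip i s = i ∧ skip i s' ∈ I) = {s} := by
    ext s'
    simp [skip_ne, (skip_injective i).eq_iff]
  rw [h, sum_singleton]

theorem proj_X_self (i : Fin k) (I : Finset (Fin k)) :
    proj i I (X i) = ∑ s with skip i s ∈ I, X s := by
  rw [proj_X]
  simp [skip_ne]

theorem proj_rename (i : Fin k) (I : Finset (Fin k)) (f : P (k - 1)) :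
    proj i I (rename (skip i) f) = f := by
  have h : (proj i I).comp (rename (skip i)) = AlgHom.id (ZMod 2) _ := by
    apply MvPolynomial.algHom_ext
    intro s
    simp [proj_X_skip]
  exact congrArg (fun φ : P (k - 1) →ₐ[ZMod 2] P (k - 1) => φ f) h

theorem Sq_proj (i : Fin k) (I : Finset (Fin k)) (a : ℕ) (f : P k) :
    Sq (k - 1) a (proj i I f) = proj i I (Sq k a f) := by
  have h : (totalSq (k - 1) : P (k - 1) →+* _).comp (proj i I : P k →+* _) =
      (Polynomial.mapRingHom (proj i I : P k →+* P (k - 1))).comp (totalSq k : P k →+* _) := by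
    apply MvPolynomial.ringHom_ext
    · intro r
      simp [totalSq, proj]
    · intro j
      simp only [RingHom.comp_apply, RingHom.coe_coe, totalSq_X, Polynomial.coe_mapRingHom,
        Polynomial.map_add, Polynomial.map_mul, Polynomial.map_C, Polynomial.map_X, map_pow,
        Polynomial.map_pow]
      rw [proj_X]
      simp only [map_sum, totalSq_X, sum_add_distrib, CharTwo.sum_sq, sum_mul, map_pow]
  have h2 := congrArg (fun φ : P k →+* Polynomial (P (k - 1)) => (φ f).coeff a) h
  simp only [RingHom.comp_apply, Polynomial.coe_mapRingHom, Polynomial.coeff_map,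
    RingHom.coe_coe] at h2
  exact h2

theorem proj_mem_hit (i : Fin k) (I : Finset (Fin k)) {f : P k} (hf : f ∈ hit k) :
    proj i I f ∈ hit (k - 1) := by
  have h : hit k ≤ (hit (k - 1)).comap (proj i I).toLinearMap := by
    refine hit_le fun a ha g => ?_
    change proj i I (Sq k a g) ∈ hit (k - 1)
    rw [← Sq_proj]
    exact Sq_mem_hit ha _
  exact h hf

theorem proj_sqfree_isHomogeneous (i : Fin k) (I A : Finset (Fin k)) :
    (proj i I (sqfree A)).IsHomogeneous #A := by
  rw [sqfree, map_prod, card_eq_sum_ones]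
  refine IsHomogeneous.prod _ _ _ fun j _ => ?_
  rw [proj_X]
  exact IsHomogeneous.sum _ _ _ fun s _ => isHomogeneous_X _ _

theorem degree_cons {k : ℕ} (A : Finset (Fin k)) (y : Mon k) :
    (cons A y).degree = #A + 2 * y.degree := by
  simp [Finsupp.degree_eq_sum, cons_apply, sum_add_distrib, mul_sum]

theorem comp_proj_sqfree_of_lt (i : Fin k) (I A : Finset (Fin k)) {J : Finset (Fin (k - 1))}
    (h : #A < #J) : comp J (proj i I (sqfree A)) = 0 := by
  ext y
  rw [coeff_comp, coeff_zero]
  apply (proj_sqfree_isHomogeneous i I A).coeff_eq_zero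
  rw [degree_cons]
  omega

theorem comp_proj_sqfree_of_eq (i : Fin k) (I A : Finset (Fin k)) {J : Finset (Fin (k - 1))}
    (h : #A = #J) : ∃ c, comp J (proj i I (sqfree A)) = MvPolynomial.C c := by
  refine ⟨coeff (0 : Mon (k - 1)) (comp J (proj i I (sqfree A))), ?_⟩
  ext y
  rw [coeff_C]
  split_ifs with hy
  · rw [hy]
  · rw [coeff_comp]
    apply (proj_sqfree_isHomogeneous i I A).coeff_eq_zero
    rw [degree_cons, h]
    have : y.degree ≠ 0 := by
      rw [Ne, Finsupp.degree_eq_zero_iff]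
      exact fun h => hy h.symm
    omega

theorem comp_proj_row (i : Fin k) (I A : Finset (Fin k)) (J : Finset (Fin (k - 1))) (f : P k) :
    comp J (proj i I (row A f)) = comp J (proj i I (sqfree A)) * proj i I f := by
  rw [row_apply, map_mul, map_pow, comp_mul_sq]

theorem comp_univ_sqfree {n : ℕ} (A : Finset (Fin n)) :
    comp univ (sqfree A) = if A = univ then 1 else 0 := by
  have h := comp_row univ A 1
  rwa [row_apply, one_pow, mul_one] at h

theorem proj_sqfree_map (i : Fin k) (I : Finset (Fin k)) (J : Finset (Fin (k - 1))) :
    proj i I (sqfree (J.map ⟨skip i, skip_injective i⟩)) = sqfree J := by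
  rw [sqfree, prod_map, map_prod]
  exact prod_congr rfl fun s _ => proj_X_skip i I s

theorem comp_univ_proj_sqfree_erase (i a : Fin k) (I : Finset (Fin k)) :
    comp univ (proj i I (sqfree (univ.erase a))) = if a ∈ insert i I then 1 else 0 := by
  by_cases hai : a = i
  · subst hai
    have h : univ.erase a = univ.map ⟨skip a, skip_injective a⟩ := by
      ext j
      simp only [mem_erase, mem_univ, and_true, mem_map, true_and, Function.Embedding.coeFn_mk]
      exact ⟨exists_skip_eq, fun ⟨s, hs⟩ => hs ▸ skip_ne a s⟩
    rw [h, proj_sqfree_map, comp_univ_sqfree]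
    simp
  · obtain ⟨a, rfl⟩ := exists_skip_eq hai
    have h : univ.erase (skip i a) =
        insert i ((univ.erase a).map ⟨skip i, skip_injective i⟩) := by
      ext j
      simp only [mem_erase, mem_univ, and_true, mem_insert, mem_map, Function.Embedding.coeFn_mk]
      constructor
      · intro hj
        by_cases hji : j = i
        · exact Or.inl hji
        · obtain ⟨s, rfl⟩ := exists_skip_eq hji
          exact Or.inr ⟨s, fun h => hj (h ▸ rfl), rfl⟩
      · rintro (rfl | ⟨s, hs, rfl⟩)
        · exact (skip_ne _ _).symm
        · exact fun h => hs (skip_injective i h)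
    have hi : i ∉ (univ.erase a).map ⟨skip i, skip_injective i⟩ := by
      simp [skip_ne]
    rw [h, sqfree_insert hi, map_mul, proj_sqfree_map, proj_X_self, sum_mul, map_sum]
    have hterm : ∀ s, comp univ (X s * sqfree (univ.erase a) : P (k - 1)) =
        if s = a then 1 else 0 := by
      intro s
      by_cases hs : s = a
      · subst hs
        rw [sqfree_erase (mem_univ s), comp_univ_sqfree, if_pos rfl, if_pos rfl]
      · have h2 : X s * sqfree (univ.erase a) = X s * row (univ.erase a) (1 : P (k - 1)) := by
          rw [row_apply, one_pow, mul_one]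
        rw [h2, X_mul_row_of_mem (by simpa using hs), comp_row, if_neg hs, if_neg]
        intro h3
        have := mem_univ s
        rw [← h3] at this
        simp at this
    simp_rw [hterm]
    simp [skip_ne]

end Proj

/-! ### Words -/

/-- Prepends to a polynomial the rows with `k - 1` ones that miss, in turn, the letters of `l`. -/
noncomputable def word {k : ℕ} : List (Fin k) → P k →ₗ[ZMod 2] P k
  | [] => LinearMap.id
  | a :: l => (row (univ.erase a)).comp (word l)

/-- The effect of `word l` on exponent vectors. -/
noncomputable def wordMon {k : ℕ} : List (Fin k) → Mon k → Mon k
  | [], y => y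
  | a :: l, y => cons (univ.erase a) (wordMon l y)

/-- The number with binary digit `1` in the positions at which the letter `j` occurs in `l`. -/
def occurrences {k : ℕ} (j : Fin k) : List (Fin k) → ℕ
  | [] => 0
  | a :: l => (if a = j then 1 else 0) + 2 * occurrences j l

section Words

variable {k : ℕ}

theorem word_nil (f : P k) : word [] f = f := rfl

theorem word_cons (a : Fin k) (l : List (Fin k)) (f : P k) :
    word (a :: l) f = row (univ.erase a) (word l f) := rfl

theorem word_append (l l' : List (Fin k)) (f : P k) : word (l ++ l') f = word l (word l' f) := by
  induction l with
  | nil => rfl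
  | cons a l ih => rw [List.cons_append, word_cons, word_cons, ih]

theorem word_monomial (l : List (Fin k)) (y : Mon k) :
    word l (monomial y 1) = monomial (wordMon l y) 1 := by
  induction l with
  | nil => rfl
  | cons a l ih => rw [word_cons, ih, row_monomial, wordMon]

theorem wordMon_add_occurrences (l : List (Fin k)) (y : Mon k) (j : Fin k) :
    wordMon l y j + occurrences j l + 1 = 2 ^ l.length * (1 + y j) := by
  induction l with
  | nil => simp [wordMon, occurrences, add_comm]
  | cons a l ih =>
    rw [wordMon, occurrences, cons_apply, List.length_cons, pow_succ]
    have h : (if j ∈ univ.erase a then 1 else 0) + (if a = j then 1 else 0) = 1 := by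
      rcases eq_or_ne a j with rfl | h
      · simp
      · simp [h, h.symm]
    linarith

theorem occurrences_append (j : Fin k) (l l' : List (Fin k)) :
    occurrences j (l ++ l') = occurrences j l + 2 ^ l.length * occurrences j l' := by
  induction l with
  | nil => simp [occurrences]
  | cons a l ih =>
    rw [List.cons_append, occurrences, occurrences, ih, List.length_cons, pow_succ]
    ring

theorem occurrences_replicate (i j : Fin k) (t : ℕ) :
    occurrences j (List.replicate t i) = if i = j then 2 ^ t - 1 else 0 := by
  induction t with
  | zero => simp [occurrences]
  | succ t ih =>
    rw [List.replicate_succ, occurrences, ih, pow_succ]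
    have := Nat.two_pow_pos t
    split_ifs <;> omega

theorem occurrences_ofFn (j : Fin k) {r : ℕ} (f : Fin r → Fin k) :
    occurrences j (List.ofFn f) = ∑ u, if f u = j then 2 ^ u.1 else 0 := by
  induction r with
  | zero => simp [occurrences]
  | succ r ih =>
    rw [List.ofFn_succ, occurrences, ih, Fin.sum_univ_succ, mul_sum]
    congr 1
    refine sum_congr rfl fun u _ => ?_
    rw [Fin.val_succ, pow_succ]
    split_ifs <;> ring

end Words

/-! ### The weight vector `ω̄` -/

section OmegaBar

variable {k : ℕ}

theorem omegaBar_one (k : ℕ) :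
    (omegaBar k 1 : ℕ → ℕ) = consWeight (k - 3) (consWeight 1 0) := by
  funext i
  rw [omegaBar, List.toFinsupp_apply]
  rcases i with _ | _ | i <;> simp [consWeight]

theorem omegaBar_add_two (k t : ℕ) :
    (omegaBar k (t + 2) : ℕ → ℕ) = consWeight (k - 1) (omegaBar k (t + 1)) := by
  funext i
  rw [omegaBar, List.toFinsupp_apply]
  rcases i with _ | i
  · simp [consWeight, List.replicate_succ]
  · simp [consWeight, omegaBar, List.toFinsupp_apply, List.replicate_succ]

theorem weight_wordMon (l : List (Fin k)) {y : Mon k}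
    (hy : (weight y : ℕ → ℕ) = omegaBar k 1) :
    weight (wordMon l y) = omegaBar k (l.length + 1) := by
  apply DFunLike.coe_injective
  induction l with
  | nil => exact hy
  | cons a l ih =>
    rw [List.length_cons, omegaBar_add_two, wordMon, weight_cons, ih]
    simp

theorem weight_bottom (J : Finset (Fin k)) (m : Fin k) (hJ : #J = k - 3) :
    (weight (cons J (Finsupp.single m 1)) : ℕ → ℕ) = omegaBar k 1 := by
  rw [weight_cons, ← cons_singleton_zero, weight_cons, weight_zero, omegaBar_one, hJ]
  simp

theorem deg_weight_cons (A : Finset (Fin k)) (y : Mon k) :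
    WeightVector.deg (weight (cons A y)) = #A + 2 * WeightVector.deg (weight y) := by
  obtain ⟨N, hN⟩ := ((weight (cons A y)).support ∪ (weight y).support).exists_nat_subset_range
  have h1 : (weight (cons A y)).support ⊆ range (N + 1) := fun i hi =>
    mem_range.2 ((mem_range.1 (hN (mem_union_left _ hi))).trans (Nat.lt_succ_self _))
  have h2 : (weight y).support ⊆ range N := fun i hi => hN (mem_union_right _ hi)
  rw [WeightVector.deg, WeightVector.deg, Finsupp.sum_of_support_subset _ h1 _ (by simp),
    Finsupp.sum_of_support_subset _ h2 _ (by simp), sum_range_succ', mul_sum, add_comm]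
  congr 1
  · simp [weight_cons_zero]
  · refine sum_congr rfl fun i _ => ?_
    rw [weight_cons_succ, pow_succ]
    ring

theorem degree_eq_deg_weight (y : Mon k) : y.degree = WeightVector.deg (weight y) := by
  induction h : y.degree using Nat.strong_induction_on generalizing y with
  | _ n ih =>
    subst h
    by_cases h0 : y = 0
    · subst h0
      simp [weight_zero, WeightVector.deg]
    · have h1 : y.degree = #(oddSet y) + 2 * (half y).degree := by
        rw [← degree_cons, cons_oddSet_half]
      have h2 : y.degree ≠ 0 := by
        rwa [Ne, Finsupp.degree_eq_zero_iff]
      rw [h1, ih _ (by omega) (half y) rfl, ← deg_weight_cons, cons_oddSet_half]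

theorem monomial_mem_PW {y : Mon k} {ω : WeightVector} (h : weight y = ω) :
    monomial y 1 ∈ PW k ω :=
  Submodule.subset_span ⟨y, by rw [degree_eq_deg_weight, h], by rw [h], rfl⟩

theorem PWminus_le_lower (ω : WeightVector) : PWminus k ω ≤ lower k ω := by
  refine Submodule.span_mono ?_
  rintro _ ⟨y, _, hy, rfl⟩
  exact ⟨y, Finsupp.Lex.lt_iff.1 hy, rfl⟩

end OmegaBar

/-! ### The generators as words -/

section Generators

variable {k : ℕ}

/-- The word `i_r … i_1 i … i` of length `t` attached to `(i; I)`, `I = (i_1, …, i_r)`. -/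
def genWord (i : Fin k) (I : Finset (Fin k)) (t : ℕ) : List (Fin k) :=
  (List.ofFn fun u : Fin #I => entry I u.rev) ++ List.replicate (t - #I) i

theorem length_genWord (i : Fin k) {I : Finset (Fin k)} {t : ℕ} (h : #I ≤ t) :
    (genWord i I t).length = t := by
  simp [genWord, h]

theorem range_entry (I : Finset (Fin k)) : Set.range (entry I) = I :=
  I.range_orderEmbOfFin rfl

theorem mem_genWord {i a : Fin k} {I : Finset (Fin k)} {t : ℕ} (h : #I < t) :
    a ∈ genWord i I t ↔ a ∈ insert i I := by
  rw [genWord, List.mem_append, List.mem_replicate, List.mem_ofFn, mem_insert, or_comm]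
  refine or_congr (and_iff_right (by omega)) ?_
  rw [← mem_coe, ← range_entry]
  constructor
  · rintro ⟨u, rfl⟩
    exact ⟨_, rfl⟩
  · rintro ⟨u, rfl⟩
    exact ⟨u.rev, by simp⟩

/-- The monomial `x_{(I,1)} = x_{i_1}^{2^{r-1}} x_{i_2}^{2^{r-2}} ⋯ x_{i_r}`. -/
noncomputable def divisor (I : Finset (Fin k)) : Mon k :=
  ∑ u : Fin #I, Finsupp.single (entry I u) (2 ^ (#I - 1 - u.1))

theorem divisor_apply (I : Finset (Fin k)) (j : Fin k) :
    divisor I j = occurrences j (List.ofFn fun u : Fin #I => entry I u.rev) := by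
  rw [occurrences_ofFn, divisor, Finsupp.finsetSum_apply, ← Equiv.sum_comp Fin.revPerm]
  refine sum_congr rfl fun u _ => ?_
  rw [Finsupp.single_apply, Fin.revPerm_apply, Fin.val_rev]
  congr 2
  omega

theorem divisor_apply_of_notMem {I : Finset (Fin k)} {j : Fin k} (h : j ∉ I) :
    divisor I j = 0 := by
  rw [divisor, Finsupp.finsetSum_apply]
  refine sum_eq_zero fun u _ => ?_
  rw [Finsupp.single_apply, if_neg]
  rintro rfl
  exact h (by rw [← mem_coe, ← range_entry]; exact ⟨u, rfl⟩)

theorem xI_zero (I : Finset (Fin k)) (hI : 0 < #I) : xI I ⟨0, hI⟩ = divisor I := by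
  have h1 : (Iic ⟨0, hI⟩ : Finset (Fin #I)) = {⟨0, hI⟩} := by
    ext u
    simp [Fin.le_def, Fin.ext_iff]
  have h2 : (Ioi ⟨0, hI⟩ : Finset (Fin #I)) = univ.erase ⟨0, hI⟩ := by
    ext u
    simp [Fin.lt_def, Fin.ext_iff, Nat.pos_iff_ne_zero]
  rw [xI, h1, h2, sum_singleton, divisor, ← add_sum_erase univ _ (mem_univ ⟨0, hI⟩)]

/-- For `x = X^{2^t-1} z^{2^t}` and `#I < t` the compatible index is the first one, and the
exponent vector of `φ_{(i;I)}(x)` is that of a word. -/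
theorem exponent_eq_wordMon {i : Fin k} {I : Finset (Fin k)} {t : ℕ} (h : #I < t) (hi : i ∉ I)
    {x z : Mon (k - 1)} (hx : ∀ s, x s = 2 ^ t - 1 + 2 ^ t * z s) :
    Finsupp.single i (2 ^ #I - 1) + fMon i x - divisor I =
      wordMon (genWord i I t) (fMon i z) := by
  ext j
  have hw := wordMon_add_occurrences (genWord i I t) (fMon i z) j
  rw [length_genWord i h.le, genWord, occurrences_append, ← divisor_apply, List.length_ofFn,
    occurrences_replicate, ← genWord] at hw
  rw [Finsupp.tsub_apply, Finsupp.add_apply]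
  have hpos := Nat.two_pow_pos t
  by_cases hj : j = i
  · subst hj
    have h0 : ∀ y : Mon (k - 1), fMon j y j = 0 := fun y =>
      Finsupp.mapDomain_of_notMem_range _ _ fun ⟨s, hs⟩ => skip_ne j s hs
    rw [if_pos rfl, h0, divisor_apply_of_notMem hi, Nat.mul_sub, ← pow_add,
      Nat.add_sub_cancel' h.le] at hw
    rw [h0, divisor_apply_of_notMem hi, Finsupp.single_eq_same]
    have : 2 ^ #I ≤ 2 ^ t := Nat.pow_le_pow_right two_pos h.le
    have := Nat.two_pow_pos #I
    omega
  · obtain ⟨s, rfl⟩ := exists_skip_eq hj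
    have hm : ∀ y : Mon (k - 1), fMon i y (skip i s) = y s := fun y =>
      Finsupp.mapDomain_apply (skip_injective i) _ _
    rw [hm, if_neg (Ne.symm hj), mul_zero, add_zero, mul_add] at hw
    rw [hm, Finsupp.single_eq_of_ne hj, hx]
    omega

theorem phiMon_eq_word {i : Fin k} {I : Finset (Fin k)} {t : ℕ} (h : #I < t)
    (hi : ∀ j ∈ I, i < j) {x z : Mon (k - 1)} (hx : ∀ s, x s = 2 ^ t - 1 + 2 ^ t * z s) :
    phiMon i I x = monomial (wordMon (genWord i I t) (fMon i z)) 1 := by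
  rw [← exponent_eq_wordMon h (fun h => (hi i h).false) hx, phiMon]
  have hnu : ∀ u : Fin #I, ∃ s, nuPred x I u = x s := by
    intro u
    have hu : entry I u ∈ I := by rw [← mem_coe, ← range_entry]; exact ⟨u, rfl⟩
    have h1 : 1 ≤ (entry I u).1 := by
      have := hi _ hu
      rw [Fin.lt_def] at this
      omega
    exact ⟨_, dif_pos h1⟩
  have hlt : 2 ^ #I < 2 ^ t := Nat.pow_lt_pow_right one_lt_two h
  have hbig : ∀ u : Fin #I, 2 ^ #I - 1 < nuPred x I u := by
    intro u
    obtain ⟨s, hs⟩ := hnu u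
    have := Nat.two_pow_pos #I
    rw [hs, hx]
    omega
  have hbit : ∀ u v : Fin #I, (nuPred x I u).testBit (#I - 1 - v.1) = true := by
    intro u v
    obtain ⟨s, hs⟩ := hnu u
    have hv : #I - 1 - v.1 < t := by omega
    have := Nat.two_pow_pos t
    rw [hs, hx, add_comm, Nat.testBit_two_pow_mul_add _ (by omega), if_pos hv,
      Nat.testBit_two_pow_sub_one, decide_eq_true hv]
  by_cases hI : I = ∅
  · have h0 : divisor I = 0 := by
      ext j
      exact divisor_apply_of_notMem (by simp [hI])
    rw [h0]
    simp [hI]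
  · have hI' : 0 < #I := card_pos.2 (nonempty_iff_ne_empty.2 hI)
    have hex : ∃ u : Fin #I, Compatible x I u :=
      ⟨⟨0, hI'⟩, fun u hu => absurd hu (by simp [Fin.lt_def]), hbig _,
        fun u _ => hbit _ u, fun u _ => hbit u u⟩
    have hu : hex.choose = ⟨0, hI'⟩ := by
      by_contra hne
      have h0 := hex.choose_spec.1 ⟨0, hI'⟩
        (Fin.lt_def.2 (Nat.pos_of_ne_zero fun h => hne (Fin.ext h)))
      exact (hbig ⟨0, hI'⟩).ne' h0
    rw [if_neg hI, dif_pos hex, hu, xI_zero]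

theorem gen_eq_word {d q : ℕ} (hq : q ≤ d - 1) (a : N k q × HitProblem.C k) :
    gen k d q a = word (genWord a.1.1.1 a.1.1.2 (d - 1))
      (rename (skip a.1.1.1) (monomial a.2.1 1)) := by
  have h : (∏ j : Fin (k - 1), (X j : P (k - 1))) ^ (2 ^ (d - 1) - 1) *
      (monomial a.2.1 1) ^ 2 ^ (d - 1) =
      monomial ((2 ^ (d - 1) - 1) • (∑ j, Finsupp.single j 1) + 2 ^ (d - 1) • a.2.1) 1 := by
    have hX : ∏ j : Fin (k - 1), (X j : P (k - 1)) = monomial (∑ j, Finsupp.single j 1) 1 := by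
      rw [monomial_sum_one]
      rfl
    rw [hX, monomial_pow, monomial_pow, monomial_mul, one_pow, one_pow, one_mul]
  have hphi : ∀ x, phi a.1.1.1 a.1.1.2 (monomial x 1) = phiMon a.1.1.1 a.1.1.2 x := by
    intro x
    have h2 := (basisMonomials (Fin (k - 1)) (ZMod 2)).constr_basis (ZMod 2)
      (phiMon a.1.1.1 a.1.1.2) x
    rw [coe_basisMonomials] at h2
    exact h2
  rw [gen, h, hphi, phiMon_eq_word (t := d - 1) (z := a.2.1) (a.1.2.2.trans_le hq) a.1.2.1,
    rename_monomial, word_monomial]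
  · rfl
  · intro s
    simp [Finsupp.single_apply]

theorem mem_C_iff {z : Mon (k - 1)} : z ∈ HitProblem.C k ↔
    ∃ J m, #J = k - 3 ∧ (∃ s ∈ J, s ≤ m) ∧ z = cons J (Finsupp.single m 1) := by
  have hz : ∀ (J : Finset (Fin (k - 1))) (m : Fin (k - 1)),
      (∑ s ∈ J, Finsupp.single s 1) + Finsupp.single m 2 = cons J (Finsupp.single m 1) := by
    intro J m
    ext j
    rw [Finsupp.add_apply, Finsupp.finsetSum_apply, cons_apply]
    by_cases h : m = j <;> simp [Finsupp.single_apply, h]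
  constructor
  · rintro ⟨J, hJ, m, hc, hm, rfl⟩
    exact ⟨J, m, hc, ⟨_, J.min'_mem hJ, hm⟩, hz J m⟩
  · rintro ⟨J, m, hc, ⟨s, hs, hm⟩, rfl⟩
    exact ⟨J, ⟨s, hs⟩, m, hc, (J.min'_le s hs).trans hm, (hz J m).symm⟩

theorem cons_single_mem_C_iff {J : Finset (Fin (k - 1))} {m : Fin (k - 1)} :
    cons J (Finsupp.single m 1) ∈ HitProblem.C k ↔ #J = k - 3 ∧ ∃ s ∈ J, s ≤ m := by
  rw [mem_C_iff]
  constructor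
  · rintro ⟨J', m', hc, hs, he⟩
    obtain ⟨rfl, h2⟩ := cons_injective he
    rw [Finsupp.single_left_inj one_ne_zero] at h2
    subst h2
    exact ⟨hc, hs⟩
  · rintro ⟨hc, hs⟩
    exact ⟨J, m, hc, hs, rfl⟩

theorem fMon_cons_single (i : Fin k) (J : Finset (Fin (k - 1))) (m : Fin (k - 1)) :
    fMon i (cons J (Finsupp.single m 1)) =
      cons (J.map ⟨skip i, skip_injective i⟩) (Finsupp.single (skip i m) 1) := by
  ext j
  by_cases hj : j = i
  · subst hj
    rw [fMon, Finsupp.mapDomain_of_notMem_range _ _ fun ⟨s, hs⟩ => skip_ne j s hs]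
    simp [cons_apply, skip_ne]
  · obtain ⟨s, rfl⟩ := exists_skip_eq hj
    rw [fMon, Finsupp.mapDomain_apply (skip_injective i), cons_apply, cons_apply]
    simp [Finsupp.single_apply, (skip_injective i).eq_iff]

theorem gen_mem_PW {d q : ℕ} (hd : 1 ≤ d) (hq : q ≤ d - 1) (a : N k q × HitProblem.C k) :
    gen k d q a ∈ PW k (omegaBar k d) := by
  obtain ⟨J, m, hJ, -, hz⟩ := mem_C_iff.1 a.2.2
  rw [gen_eq_word hq, rename_monomial, word_monomial]
  refine monomial_mem_PW ?_
  have h := weight_wordMon (genWord a.1.1.1 a.1.1.2 (d - 1))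
    (y := a.2.1.mapDomain (skip a.1.1.1)) ?_
  · rw [h, length_genWord _ (a.1.2.2.trans_le hq).le, Nat.sub_add_cancel hd]
  · change (weight (fMon a.1.1.1 a.2.1) : ℕ → ℕ) = _
    rw [hz, fMon_cons_single]
    exact weight_bottom _ _ (by rw [card_map, hJ])

end Generators

/-! ### Linear independence -/

section Independence

variable {k : ℕ}

theorem pow_comp_univ_proj_word (i : Fin k) (I : Finset (Fin k)) (l : List (Fin k)) (f : P k) :
    (comp univ ^ l.length) (proj i I (word l f)) =
      if ∀ a ∈ l, a ∈ insert i I then proj i I f else 0 := by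
  induction l with
  | nil => simp [word_nil]
  | cons a l ih =>
    rw [List.length_cons, pow_succ, Module.End.mul_apply, word_cons, comp_proj_row,
      comp_univ_proj_sqfree_erase]
    by_cases h : a ∈ insert i I
    · rw [if_pos h, one_mul, ih]
      simp only [List.forall_mem_cons, h, true_and]
    · rw [if_neg h, zero_mul, map_zero, if_neg fun h2 => h (h2 a List.mem_cons_self)]

theorem pow_comp_univ_mem_hit (t : ℕ) {f : P k} (hf : f ∈ hit k) :
    (comp univ ^ t) f ∈ hit k := by
  induction t generalizing f with
  | zero => exact hf
  | succ t ih => exact ih (comp_univ_mem_hit hf)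

theorem exists_eq_erase {A : Finset (Fin k)} (hA : #A + 1 = k) : ∃ a, A = univ.erase a := by
  have h : #Aᶜ = 1 := by rw [card_compl, Fintype.card_fin]; omega
  obtain ⟨a, ha⟩ := card_eq_one.1 h
  refine ⟨a, ?_⟩
  rw [← compl_compl A, ha]
  ext j
  simp

theorem proj_mem_bottomRelations (hk : 3 ≤ k) (i : Fin k) (I : Finset (Fin k)) {y : Mon k}
    (hy : LexLT (weight y) (omegaBar k 1)) :
    proj i I (monomial y 1) ∈ bottomRelations (k - 1) := by
  refine mem_bottomRelations_of_forall fun J m hJ => ?_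
  have hJ' : #J = k - 3 := by omega
  rw [← cons_oddSet_half y, weight_cons, omegaBar_one, lexLT_consWeight] at hy
  rw [monomial_eq_row, bottomCoeff_apply, comp_proj_row]
  rcases hy with hlt | ⟨heq, hy⟩
  · rw [comp_proj_sqfree_of_lt i I _ (by omega), zero_mul, coeff_zero]
  · obtain ⟨c, hc⟩ := comp_proj_sqfree_of_eq i I (oddSet y) (J := J) (by omega)
    have hodd : oddSet (half y) = ∅ := by
      rw [← cons_oddSet_half (half y), weight_cons, lexLT_consWeight] at hy
      rcases hy with h | ⟨-, j, -, h⟩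
      · rwa [Nat.lt_one_iff, card_eq_zero] at h
      · exact absurd h (Nat.not_lt_zero _)
    -- The image of `half y` is a square, so it has no linear term.
    rw [hc, coeff_C_mul, coeff_single_eq_constantCoeff_comp, monomial_eq_row (half y), hodd,
      comp_proj_row, comp_proj_sqfree_of_lt i I _ (by simp), zero_mul, map_zero, mul_zero]

theorem pow_comp_univ_proj_mem_bottomRelations (hk : 3 ≤ k) (i : Fin k) (I : Finset (Fin k))
    (t : ℕ) {f : P k} (hf : f ∈ lower k (omegaBar k (t + 1))) :
    (comp univ ^ t) (proj i I f) ∈ bottomRelations (k - 1) := by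
  have h : ∀ y : Mon k, LexLT (weight y) (omegaBar k (t + 1)) →
      (comp univ ^ t) (proj i I (monomial y 1)) ∈ bottomRelations (k - 1) := by
    clear hf
    induction t with
    | zero => exact fun y hy => proj_mem_bottomRelations hk i I hy
    | succ t ih =>
      intro y hy
      rw [← cons_oddSet_half y, weight_cons, omegaBar_add_two, lexLT_consWeight] at hy
      rw [pow_succ, Module.End.mul_apply, monomial_eq_row, comp_proj_row]
      rcases hy with hlt | ⟨heq, hy⟩
      · rw [comp_proj_sqfree_of_lt i I _ (by simpa using hlt), zero_mul, map_zero]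
        exact zero_mem _
      · obtain ⟨a, ha⟩ := exists_eq_erase (A := oddSet y) (by omega)
        rw [ha, comp_univ_proj_sqfree_erase]
        split_ifs
        · rw [one_mul]
          exact ih _ hy
        · rw [zero_mul, map_zero]
          exact zero_mem _
  have h2 : lower k (omegaBar k (t + 1)) ≤
      (bottomRelations (k - 1)).comap ((comp univ ^ t).comp (proj i I).toLinearMap) := by
    refine Submodule.span_le.2 ?_
    rintro _ ⟨y, hy, rfl⟩
    exact h y hy
  exact h2 hf

/-- The map induced by `proj i I` and `t` applications of Kameko's down map. -/
noncomputable def detect (hk : 3 ≤ k) (t : ℕ) (i : Fin k) (I : Finset (Fin k)) :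
    QP k (omegaBar k (t + 1)) →ₗ[ZMod 2] P (k - 1) ⧸ bottomRelations (k - 1) :=
  Submodule.liftQ _ ((bottomRelations (k - 1)).mkQ.comp
    (((comp univ ^ t).comp (proj i I).toLinearMap).comp (PW k _).subtype)) <| by
      intro f hf
      rw [LinearMap.mem_ker, LinearMap.comp_apply, Submodule.mkQ_apply,
        Submodule.Quotient.mk_eq_zero]
      obtain ⟨g, hg, h, hh, hgh⟩ := Submodule.mem_sup.1 hf
      have hsum : (comp univ ^ t) (proj i I g) + (comp univ ^ t) (proj i I h) =
          (comp univ ^ t) (proj i I f) := by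
        rw [← map_add, ← map_add, hgh]
        rfl
      change (comp univ ^ t) (proj i I f) ∈ _
      rw [← hsum]
      exact add_mem
        (hit_le_bottomRelations _ (pow_comp_univ_mem_hit t (proj_mem_hit i I hg.1)))
        (pow_comp_univ_proj_mem_bottomRelations hk i I t (PWminus_le_lower _ hh))

theorem detect_cls (hk : 3 ≤ k) (t : ℕ) (i : Fin k) (I : Finset (Fin k)) (f : P k)
    (hf : f ∈ PW k (omegaBar k (t + 1))) : detect hk t i I (cls f hf) =
      (bottomRelations (k - 1)).mkQ ((comp univ ^ t) (proj i I f)) := rfl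

/-- The elements of `C_k` are independent modulo `bottomRelations`: for each `b` at least one of
the monomials `(∏_{j ≠ b, m} x_j) x_m²` is not in `C_k`, so a combination of elements of `C_k`
that satisfies the relations has all coefficients `0`. -/
theorem linearIndependent_C (hk : 3 ≤ k) : LinearIndependent (ZMod 2)
    fun z : HitProblem.C k => (bottomRelations (k - 1)).mkQ (monomial z.1 1) := by
  rw [linearIndependent_iff']
  intro s g hg z hz
  replace hg : ∑ z ∈ s, g z • (monomial z.1 1 : P (k - 1)) ∈ bottomRelations (k - 1) := by
    rw [← Submodule.Quotient.mk_eq_zero, ← Submodule.mkQ_apply, map_sum]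
    exact (sum_congr rfl fun z _ => map_smul _ _ _).trans hg
  have hcoeff : ∀ y : Mon (k - 1), coeff y (∑ z ∈ s, g z • (monomial z.1 1 : P (k - 1))) =
      ∑ z ∈ s, if z.1 = y then g z else 0 := by
    intro y
    rw [coeff_sum]
    refine sum_congr rfl fun z _ => ?_
    rw [coeff_smul, coeff_monomial]
    simp
  have hgz : coeff z.1 (∑ z ∈ s, g z • (monomial z.1 1 : P (k - 1))) = g z := by
    rw [hcoeff, sum_eq_single_of_mem z hz]
    · simp
    · intro z' _ hne
      rw [if_neg fun h => hne (Subtype.ext h)]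
  have hnot : ∀ y, y ∉ HitProblem.C k →
      coeff y (∑ z ∈ s, g z • (monomial z.1 1 : P (k - 1))) = 0 := by
    intro y hy
    rw [hcoeff]
    refine sum_eq_zero fun z' _ => if_neg ?_
    rintro rfl
    exact hy z'.2
  obtain ⟨J, m, hJ, -, hzJ⟩ := mem_C_iff.1 z.2
  rw [← hgz, hzJ, ← coeff_comp, ← bottomCoeff_apply]
  by_cases hm : m ∈ J
  · exact hg.1 J m (by omega) hm
  · have h2 : #Jᶜ = 2 := by rw [card_compl, Fintype.card_fin]; omega
    obtain ⟨b, hbm, hb⟩ : ∃ b, b ≠ m ∧ J = {b, m}ᶜ := by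
      obtain ⟨b, c, hbc, h⟩ := card_eq_two.1 h2
      have hmem : m ∈ ({b, c} : Finset (Fin (k - 1))) := by
        rw [← h]
        exact mem_compl.2 hm
      rw [mem_insert, mem_singleton] at hmem
      rcases hmem with rfl | rfl
      · exact ⟨c, hbc.symm, by rw [pair_comm, ← h, compl_compl]⟩
      · exact ⟨b, hbc, by rw [← h, compl_compl]⟩
    have hpivot : ∃ m', b ≠ m' ∧ ∀ s ∈ ({b, m'} : Finset (Fin (k - 1)))ᶜ, ¬ s ≤ m' := by
      by_cases hb0 : b.1 = 0
      · refine ⟨⟨1, by omega⟩, fun h => by simp [h] at hb0, fun s hs hle => ?_⟩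
        simp only [mem_compl, mem_insert, mem_singleton, not_or, Fin.ext_iff] at hs
        rw [Fin.le_def] at hle
        simp only at hs hle
        omega
      · refine ⟨⟨0, by omega⟩, fun h => by simp [h] at hb0, fun s hs hle => ?_⟩
        simp only [mem_compl, mem_insert, mem_singleton, not_or, Fin.ext_iff] at hs
        rw [Fin.le_def] at hle
        simp only at hs hle
        omega
    obtain ⟨m', hbm', hm'⟩ := hpivot
    rw [hb, hg.2 b m m' hbm hbm', bottomCoeff_apply, coeff_comp]
    refine hnot _ fun hC => ?_
    obtain ⟨-, s, hs, hle⟩ := cons_single_mem_C_iff.1 hC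
    exact hm' s hs hle

/-- Linear independence by triangularity with respect to inclusion of finite sets. -/
theorem linearIndependent_of_triangular {ι κ α K M W : Type*} [Field K] [AddCommGroup M]
    [Module K M] [AddCommGroup W] [Module K W] (S : ι → Finset α)
    (hS : Function.Injective S) (v : ι × κ → M) (L : ι → M →ₗ[K] W)
    (h0 : ∀ n n' z, ¬ S n' ⊆ S n → L n (v (n', z)) = 0)
    (h1 : ∀ n, LinearIndependent K fun z => L n (v (n, z))) : LinearIndependent K v := by
  classical
  rw [linearIndependent_iff']
  intro s g hg
  have key : ∀ r n, #(S n) = r → ∀ z, (n, z) ∈ s → g (n, z) = 0 := by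
    intro r
    induction r using Nat.strong_induction_on with
    | _ r ih =>
      rintro n rfl z hz
      have h2 := congrArg (L n) hg
      rw [map_sum, map_zero, ← sum_filter_add_sum_filter_not s (fun p => p.1 = n),
        sum_eq_zero (s := s.filter fun p => ¬ p.1 = n), add_zero] at h2
      · have h3 : ∑ z ∈ (s.filter fun p => p.1 = n).image Prod.snd,
            g (n, z) • L n (v (n, z)) = 0 := by
          rw [← h2, sum_image]
          · refine sum_congr rfl fun p hp => ?_
            obtain ⟨-, rfl⟩ := mem_filter.1 hp
            rw [map_smul]
          · intro p hp p' hp' h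
            exact Prod.ext ((mem_filter.1 hp).2.trans (mem_filter.1 hp').2.symm) h
        refine linearIndependent_iff'.1 (h1 n) _ (fun z => g (n, z)) h3 z ?_
        exact mem_image.2 ⟨(n, z), mem_filter.2 ⟨hz, rfl⟩, rfl⟩
      · rintro ⟨n', z'⟩ hp
        obtain ⟨hps, hne⟩ := mem_filter.1 hp
        by_cases hsub : S n' ⊆ S n
        · have hlt : #(S n') < #(S n) :=
            card_lt_card (hsub.ssubset_of_ne fun h => hne (hS h))
          rw [ih _ hlt n' rfl z' hps, zero_smul, map_zero]
        · rw [map_smul, h0 n n' z' hsub, smul_zero]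
  exact fun p hp => key _ p.1 rfl p.2 hp

/-- The set `{i} ∪ I` attached to `(i; I)`. -/
def support {q : ℕ} (n : N k q) : Finset (Fin k) := insert n.1.1 n.1.2

theorem support_injective {q : ℕ} : Function.Injective (support : N k q → Finset (Fin k)) := by
  have hle : ∀ n : N k q, ∀ a ∈ support n, n.1.1 ≤ a := by
    intro n a ha
    rcases mem_insert.1 ha with rfl | h
    · exact le_rfl
    · exact (n.2.1 a h).le
  intro n n' h
  have hi : n.1.1 = n'.1.1 := le_antisymm
    (hle n _ (h ▸ mem_insert_self _ _)) (hle n' _ (h ▸ mem_insert_self _ _))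
  refine Subtype.ext (Prod.ext hi ?_)
  have hn : n.1.1 ∉ n.1.2 := fun h => (n.2.1 _ h).false
  have hn' : n'.1.1 ∉ n'.1.2 := fun h => (n'.2.1 _ h).false
  rw [← erase_insert hn, ← erase_insert hn', ← hi]
  rw [support, support, ← hi] at h
  rw [h]

/-- The classes are detected by the maps `detect`: the word of `(i'; I')` survives under
`(i; I)` only if `{i'} ∪ I' ⊆ {i} ∪ I`. -/
theorem linearIndependent_cls_gen {t q : ℕ} (hk : 3 ≤ k) (hq : q ≤ t)
    (hmem : ∀ a : N k q × HitProblem.C k, gen k (t + 1) q a ∈ PW k (omegaBar k (t + 1))) :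
    LinearIndependent (ZMod 2) fun a => cls (gen k (t + 1) q a) (hmem a) := by
  have hL : ∀ (n n' : N k q) (z : HitProblem.C k),
      detect hk t n.1.1 n.1.2 (cls (gen k (t + 1) q (n', z)) (hmem (n', z))) =
        if support n' ⊆ support n then (bottomRelations (k - 1)).mkQ
          (proj n.1.1 n.1.2 (rename (skip n'.1.1) (monomial z.1 1))) else 0 := by
    intro n n' z
    have hcard : #n'.1.2 < t := n'.2.2.trans_le hq
    have h := pow_comp_univ_proj_word n.1.1 n.1.2 (genWord n'.1.1 n'.1.2 t)
      (rename (skip n'.1.1) (monomial z.1 1))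
    rw [length_genWord _ hcard.le] at h
    rw [detect_cls, gen_eq_word (by simpa using hq), Nat.add_sub_cancel, h]
    have hsub : (∀ a ∈ genWord n'.1.1 n'.1.2 t, a ∈ insert n.1.1 n.1.2) ↔
        support n' ⊆ support n := by
      simp only [mem_genWord hcard]
      exact Iff.rfl
    simp only [hsub]
    rw [apply_ite (bottomRelations (k - 1)).mkQ, map_zero]
  refine linearIndependent_of_triangular support support_injective _
    (fun n => detect hk t n.1.1 n.1.2) (fun n n' z h => ?_) fun n => ?_
  · rw [hL, if_neg h]
  · simp only [hL, if_pos Subset.rfl, proj_rename]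
    exact linearIndependent_C hk

end Independence

/-! ### Relations between words -/

/-- The sequence `(c, …, c, ω_1, ω_2, …)` with `t` entries `c` in front. -/
def stack (c : ℕ) : ℕ → (ℕ → ℕ) → ℕ → ℕ
  | 0, ω => ω
  | t + 1, ω => consWeight c (stack c t ω)

section Relations

variable {k : ℕ}

theorem omegaBar_eq_stack (k t : ℕ) :
    (omegaBar k (t + 1) : ℕ → ℕ) = stack (k - 1) t (omegaBar k 1) := by
  induction t with
  | zero => rfl
  | succ t ih => rw [omegaBar_add_two, ih, stack]

theorem stack_add (c s t : ℕ) (ω : ℕ → ℕ) : stack c (s + t) ω = stack c s (stack c t ω) := by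
  induction s with
  | zero => rw [Nat.zero_add, stack]
  | succ s ih => rw [Nat.succ_add, stack, stack, ih]

theorem card_erase_univ (a : Fin k) : #(univ.erase a) = k - 1 := by
  simp

theorem word_mem_hitLower (l : List (Fin k)) {ω : ℕ → ℕ} {f : P k} (hf : f ∈ hitLower k ω) :
    word l f ∈ hitLower k (stack (k - 1) l.length ω) := by
  induction l with
  | nil => exact hf
  | cons a l ih =>
    rw [word_cons, List.length_cons, stack, ← card_erase_univ a]
    rw [← card_erase_univ a] at ih
    exact row_mem_hitLower ih

theorem word_mem_lower (l : List (Fin k)) {ω : ℕ → ℕ} {f : P k} (hf : f ∈ lower k ω) :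
    word l f ∈ lower k (stack (k - 1) l.length ω) := by
  induction l with
  | nil => exact hf
  | cons a l ih =>
    rw [word_cons, List.length_cons, stack, ← card_erase_univ a]
    rw [← card_erase_univ a] at ih
    exact row_mem_lower ih

theorem word_congr (l : List (Fin k)) {ω : ℕ → ℕ} {f g : P k}
    (h : f ≡ g [SMOD hitLower k ω]) :
    word l f ≡ word l g [SMOD hitLower k (stack (k - 1) l.length ω)] := by
  rw [SModEq.sub_mem] at h ⊢
  rw [← map_sub]
  exact word_mem_hitLower l h

theorem X_mul_pow_row_univ (j : Fin k) (e : ℕ) (f : P k) :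
    X j * (row univ ^ e) f = word (List.replicate e j) (X j * f) := by
  induction e with
  | zero => rfl
  | succ e ih =>
    rw [pow_succ', Module.End.mul_apply, X_mul_row_of_mem (mem_univ j), ih, List.replicate_succ,
      word_cons]

/-- `Sq^1` of `X^{2^e-1} f^{2^e}`, with `X` the product of all variables. -/
theorem sum_word_replicate_mem_hit {e : ℕ} (he : 1 ≤ e) (f : P k) :
    ∑ j, word (List.replicate e j) (X j * f) ∈ hit k := by
  obtain ⟨e, rfl⟩ := Nat.exists_eq_add_of_le' he
  have h := Sq_mem_hit le_rfl (row univ ((row univ ^ e) f))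
  rw [Sq_one_row] at h
  simp_rw [X_mul_pow_row_univ] at h
  exact h

theorem sum_word_replicate_row_mem {e : ℕ} (he : 1 ≤ e) {A : Finset (Fin k)} {ω : ℕ → ℕ}
    (hω : ω 0 = #A + 1) (f : P k) :
    ∑ j ∈ Aᶜ, word (List.replicate e j) (row (insert j A) f) ∈
      hitLower k (stack (k - 1) e ω) := by
  have h := sum_word_replicate_mem_hit he (row A f)
  rw [← sum_add_sum_compl A] at h
  have hA : ∑ j ∈ A, word (List.replicate e j) (X j * row A f) ∈
      lower k (stack (k - 1) e ω) := by
    refine sum_mem fun j hj => ?_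
    have h2 := word_mem_lower (List.replicate e j) (ω := ω) (f := X j * row A f) ?_
    · rwa [List.length_replicate] at h2
    · rw [X_mul_row_of_mem hj]
      refine row_mem_lower_of_card_lt ?_ _
      rw [hω, card_erase_of_mem hj]
      omega
  have hAc : ∑ j ∈ Aᶜ, word (List.replicate e j) (row (insert j A) f) =
      ∑ j ∈ Aᶜ, word (List.replicate e j) (X j * row A f) :=
    sum_congr rfl fun j hj => by rw [X_mul_row_of_notMem (mem_compl.1 hj)]
  rw [hAc, ← add_sub_cancel_left (∑ j ∈ A, word (List.replicate e j) (X j * row A f))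
    (∑ j ∈ Aᶜ, word (List.replicate e j) (X j * row A f))]
  exact sub_mem (Submodule.mem_sup_left h) (Submodule.mem_sup_right hA)

/-- `a^e b` and `b^e a` are equivalent words. -/
theorem word_replicate_swap {e : ℕ} (he : 1 ≤ e) {a b : Fin k} (hab : a ≠ b) (ω : ℕ → ℕ)
    (f : P k) : word (List.replicate e a ++ [b]) f ≡ word (List.replicate e b ++ [a]) f
      [SMOD hitLower k (stack (k - 1) (e + 1) ω)] := by
  have hk := card_le_univ ({a, b} : Finset (Fin k))
  rw [Fintype.card_fin, card_pair hab] at hk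
  have h := sum_word_replicate_row_mem he (A := {a, b}ᶜ) (ω := consWeight (k - 1) ω)
    (by rw [consWeight, card_compl, card_pair hab, Fintype.card_fin]; omega) f
  have ha : insert a ({a, b} : Finset (Fin k))ᶜ = univ.erase b := by
    ext j
    simp only [mem_insert, mem_compl, mem_singleton, mem_erase, mem_univ]
    grind
  have hb : insert b ({a, b} : Finset (Fin k))ᶜ = univ.erase a := by
    ext j
    simp only [mem_insert, mem_compl, mem_singleton, mem_erase, mem_univ]
    grind
  rw [compl_compl, sum_pair hab, ha, hb] at h
  rw [SModEq.sub_mem, CharTwo.sub_eq_add, stack_add]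
  simpa [word_append, word_cons, word_nil, stack] using h

theorem word_perm {l l' : List (Fin k)} (h : l.Perm l') (ω : ℕ → ℕ) (f : P k) :
    word l f ≡ word l' f [SMOD hitLower k (stack (k - 1) l.length ω)] := by
  induction h with
  | nil => exact SModEq.rfl
  | cons a _ ih => exact word_congr [a] ih
  | swap a b l =>
    by_cases hab : b = a
    · rw [hab]
    · have := word_replicate_swap le_rfl hab (stack (k - 1) l.length ω) (word l f)
      simpa [word_append, word_cons, word_nil, stack] using this
  | trans h1 _ ih1 ih2 =>
    rw [← h1.length_eq] at ih2
    exact ih1.trans ih2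

theorem word_cons_congr {l : List (Fin k)} {a b : Fin k} (ha : a ∈ l) (hb : b ∈ l) (ω : ℕ → ℕ)
    (f : P k) : word (a :: l) f ≡ word (b :: l) f
      [SMOD hitLower k (stack (k - 1) (l.length + 1) ω)] := by
  by_cases hab : a = b
  · rw [hab]
  · have h1 := List.perm_cons_erase ha
    have h2 := List.perm_cons_erase ((List.mem_erase_of_ne (Ne.symm hab)).2 hb)
    set l' := (l.erase a).erase b
    have h3 : l.Perm (a :: b :: l') := h1.trans (h2.cons a)
    have hlen : l.length + 1 = 2 + 1 + l'.length := by
      rw [h3.length_eq, List.length_cons, List.length_cons]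
      omega
    have h4 := word_replicate_swap one_le_two hab (stack (k - 1) l'.length ω) (word l' f)
    rw [← stack_add, ← hlen, ← word_append, ← word_append] at h4
    have h5 : (b :: b :: a :: l').Perm (b :: l) :=
      ((List.Perm.swap a b l').trans h3.symm).cons b
    have h6 := word_perm h5 ω f
    rw [h5.length_eq] at h6
    exact (word_perm (h3.cons a) ω f).trans (h4.trans h6)

theorem exists_perm_cons_of_not_nodup {l : List (Fin k)} (h : ¬ l.Nodup) :
    ∃ a l', a ∈ l' ∧ l.Perm (a :: l') := by
  obtain ⟨a, ha⟩ := List.exists_duplicate_iff_not_nodup.2 h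
  refine ⟨a, l.erase a, ?_, List.perm_cons_erase ha.mem⟩
  rw [← List.count_pos_iff, List.count_erase_self]
  have := List.duplicate_iff_two_le_count.1 ha
  omega

/-- Modulo hit polynomials and lower weights, a word of given length is determined by the set of
its letters. -/
theorem word_congr_of_toFinset_eq (t : ℕ) {l l' : List (Fin k)} (hl : l.length = t)
    (hl' : l'.length = t) (h : l.toFinset = l'.toFinset) (ω : ℕ → ℕ) (f : P k) :
    word l f ≡ word l' f [SMOD hitLower k (stack (k - 1) t ω)] := by
  induction t generalizing l l' with
  | zero =>
    rw [List.length_eq_zero_iff] at hl hl'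
    rw [hl, hl']
  | succ t ih =>
    have hnodup : ∀ l : List (Fin k), #l.toFinset = l.length ↔ l.Nodup := fun l => by
      rw [List.card_toFinset, ← List.dedup_eq_self]
      exact ⟨fun h => (List.dedup_sublist l).eq_of_length h, fun h => by rw [h]⟩
    by_cases hn : l.Nodup
    · have hn' : l'.Nodup := by
        rw [← hnodup, hl', ← hl, ← h]
        exact (hnodup l).2 hn
      have := word_perm (List.perm_of_nodup_nodup_toFinset_eq hn hn' h) ω f
      rwa [hl] at this
    · have hn' : ¬ l'.Nodup := by
        rw [← hnodup, hl', ← hl, ← h]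
        exact mt (hnodup l).1 hn
      obtain ⟨a, m, ham, hm⟩ := exists_perm_cons_of_not_nodup hn
      obtain ⟨b, m', hbm, hm'⟩ := exists_perm_cons_of_not_nodup hn'
      have hms : l.toFinset = m.toFinset := by
        rw [List.toFinset_eq_of_perm _ _ hm, List.toFinset_cons,
          insert_eq_of_mem (List.mem_toFinset.2 ham)]
      have hms' : l'.toFinset = m'.toFinset := by
        rw [List.toFinset_eq_of_perm _ _ hm', List.toFinset_cons,
          insert_eq_of_mem (List.mem_toFinset.2 hbm)]
      have hlm : m.length = t := by
        have := hm.length_eq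
        rw [List.length_cons] at this
        omega
      have hlm' : m'.length = t := by
        have := hm'.length_eq
        rw [List.length_cons] at this
        omega
      have ham' : a ∈ m' := by
        rw [← List.mem_toFinset, ← hms', ← h, hms, List.mem_toFinset]
        exact ham
      have h1 := word_perm hm ω f
      have h2 := word_congr [a] (ih hlm hlm' (hms.symm.trans (h.trans hms')))
      have h3 := word_cons_congr ham' hbm ω f
      have h4 := word_perm hm'.symm ω f
      rw [hl] at h1
      rw [hlm'] at h3
      rw [List.length_cons, hlm'] at h4
      exact h1.trans (h2.trans (h3.trans h4))

end Relations

/-! ### Symbols indexed by sets of letters -/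

section Symbols

variable {k : ℕ}

open Classical in
/-- The class of `word l f` for any word `l` of length `t` with set of letters `S`, modulo hit
polynomials and lower weights; it is `0` if there is no such word. -/
noncomputable def symbol (t : ℕ) (ω : ℕ → ℕ) (S : Finset (Fin k)) :
    P k →ₗ[ZMod 2] P k ⧸ hitLower k (stack (k - 1) t ω) :=
  if h : ∃ l : List (Fin k), l.length = t ∧ l.toFinset = S then
    (hitLower k (stack (k - 1) t ω)).mkQ.comp (word h.choose)
  else 0

theorem symbol_toFinset {t : ℕ} {l : List (Fin k)} (hl : l.length = t) (ω : ℕ → ℕ) (f : P k) :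
    symbol t ω l.toFinset f = (hitLower k (stack (k - 1) t ω)).mkQ (word l f) := by
  have h : ∃ l' : List (Fin k), l'.length = t ∧ l'.toFinset = l.toFinset := ⟨l, hl, rfl⟩
  rw [symbol, dif_pos h]
  exact word_congr_of_toFinset_eq t h.choose_spec.1 hl h.choose_spec.2 ω f

theorem symbol_eq_zero_of_mem_hit {f : P k} (hf : f ∈ hit k) (t : ℕ) (ω : ℕ → ℕ)
    (S : Finset (Fin k)) : symbol t ω S f = 0 := by
  by_cases h : ∃ l : List (Fin k), l.length = t ∧ l.toFinset = S
  · obtain ⟨l, rfl, rfl⟩ := h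
    rw [symbol_toFinset rfl, Submodule.mkQ_apply, Submodule.Quotient.mk_eq_zero]
    exact word_mem_hitLower l (Submodule.mem_sup_left hf)
  · rw [symbol, dif_neg h, LinearMap.zero_apply]

theorem exists_list_toFinset_eq {S : Finset (Fin k)} (hS : S.Nonempty) {t : ℕ} (h : #S ≤ t) :
    ∃ l : List (Fin k), l.length = t ∧ l.toFinset = S := by
  obtain ⟨a, ha⟩ := hS
  refine ⟨S.toList ++ List.replicate (t - #S) a, by simp [h], ?_⟩
  ext j
  simp only [List.mem_toFinset, List.mem_append, mem_toList, List.mem_replicate]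
  constructor
  · rintro (h | ⟨-, rfl⟩)
    · exact h
    · exact ha
  · exact Or.inl

theorem sum_symbol_insert_of_card_lt {t : ℕ} {ω : ℕ → ℕ} {S A : Finset (Fin k)} (hS : #S < t)
    (hω : ω 0 = #A + 1) (f : P k) :
    ∑ j ∈ Aᶜ, symbol t ω (insert j S) (row (insert j A) f) = 0 := by
  rcases S.eq_empty_or_nonempty with rfl | hne
  · have h := sum_word_replicate_row_mem (e := t) (by omega) hω f
    rw [← Submodule.Quotient.mk_eq_zero, ← Submodule.mkQ_apply, map_sum] at h
    rw [← h]
    refine sum_congr rfl fun j _ => ?_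
    have hj : insert j ∅ = (List.replicate t j).toFinset := by
      rw [List.toFinset_replicate_of_ne_zero (by omega), insert_empty_eq]
    rw [hj, symbol_toFinset (List.length_replicate ..)]
  · obtain ⟨t, rfl⟩ : ∃ s, t = s + 1 := ⟨t - 1, by omega⟩
    obtain ⟨l, hl, rfl⟩ := exists_list_toFinset_eq hne (t := t) (by omega)
    have h := word_mem_hitLower l (sum_word_replicate_row_mem le_rfl hω f)
    rw [← stack_add, hl, ← Submodule.Quotient.mk_eq_zero, ← Submodule.mkQ_apply, map_sum,
      map_sum] at h
    rw [← h]
    refine sum_congr rfl fun j _ => ?_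
    have hj : insert j l.toFinset = (l ++ List.replicate 1 j).toFinset := by
      ext s
      simp
    rw [hj, symbol_toFinset (by simp [hl]), word_append]

/-- In characteristic two the values of `g` at the sets containing `j` appear in pairs. -/
theorem sum_insert_eq_zero {M : Type*} [AddCommGroup M] [Module (ZMod 2) M]
    {B : Finset (Fin k)} {j : Fin k} (hj : j ∉ B) (g : Finset (Fin k) → M) :
    ∑ S with B ⊆ S, g (insert j S) = 0 := by
  have hinv : ∀ S : Finset (Fin k), symmDiff (symmDiff S {j}) {j} = S := fun S => by
    rw [symmDiff_assoc, symmDiff_self, symmDiff_bot]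
  refine sum_involution (fun S _ => symmDiff S {j}) (fun S _ => ?_) (fun S _ _ h => ?_)
    (fun S hS => ?_) fun S _ => hinv S
  · have h : insert j (symmDiff S {j}) = insert j S := by
      ext s
      simp only [mem_insert, mem_symmDiff, mem_singleton]
      grind
    rw [h, ← two_smul (ZMod 2) (g (insert j S))]
    exact zero_smul _ _
  · have := congrArg (j ∈ ·) h
    simp [mem_symmDiff] at this
  · rw [mem_filter] at hS ⊢
    refine ⟨mem_univ _, fun s hs => ?_⟩
    have hsj : s ≠ j := fun h => hj (h ▸ hs)
    simp [mem_symmDiff, hS.2 hs, hsj]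

/-- If words are at least as long as there are variables, the relation holds for all `S`: for the
full set it is the sum of the relations for all other sets. -/
theorem sum_symbol_insert {t : ℕ} (ht : k ≤ t) {ω : ℕ → ℕ} (S : Finset (Fin k))
    {A : Finset (Fin k)} (hω : ω 0 = #A + 1) (f : P k) :
    ∑ j ∈ Aᶜ, symbol t ω (insert j S) (row (insert j A) f) = 0 := by
  have hlt : ∀ S : Finset (Fin k), S ≠ univ → #S < t := fun S hS => by
    have := (card_lt_iff_ne_univ S).2 hS
    rw [Fintype.card_fin] at this
    omega
  by_cases hS : S = univ
  · have h : ∑ S : Finset (Fin k), ∑ j ∈ Aᶜ, symbol t ω (insert j S) (row (insert j A) f) = 0 := by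
      rw [sum_comm]
      refine sum_eq_zero fun j _ => ?_
      have := sum_insert_eq_zero (notMem_empty j)
        fun S => symbol t ω S (row (insert j A) f)
      simpa using this
    rw [sum_eq_single univ] at h
    · rw [hS, h]
    · exact fun S _ hS => sum_symbol_insert_of_card_lt (hlt S hS) hω f
    · exact fun h => absurd (mem_univ _) h
  · exact sum_symbol_insert_of_card_lt (hlt S hS) hω f

/-- If the symbol of `S` is thought of as the function `∏_{j ∈ S} e_j` on `𝔽₂^k`, with `e_j` the
coordinates, this is the indicator function of the point with support `B`. In these terms the
relations decouple. -/
noncomputable def pointSymbol (t : ℕ) (ω : ℕ → ℕ) (B : Finset (Fin k)) :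
    P k →ₗ[ZMod 2] P k ⧸ hitLower k (stack (k - 1) t ω) :=
  ∑ S with B ⊆ S, symbol t ω S

theorem sum_pointSymbol_row {t : ℕ} (ht : k ≤ t) {ω : ℕ → ℕ} (B : Finset (Fin k))
    {A : Finset (Fin k)} (hω : ω 0 = #A + 1) (f : P k) :
    ∑ j ∈ Aᶜ ∩ B, pointSymbol t ω B (row (insert j A) f) = 0 := by
  have h : ∑ S with B ⊆ S, ∑ j ∈ Aᶜ, symbol t ω (insert j S) (row (insert j A) f) = 0 :=
    sum_eq_zero fun S _ => sum_symbol_insert ht S hω f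
  rw [sum_comm, ← sum_inter_add_sum_sdiff Aᶜ B, sum_eq_zero (s := Aᶜ \ B), add_zero] at h
  · rw [← h]
    refine sum_congr rfl fun j hj => ?_
    rw [pointSymbol, LinearMap.sum_apply]
    refine sum_congr rfl fun S hS => ?_
    rw [insert_eq_of_mem ((mem_filter.1 hS).2 (mem_inter.1 hj).2)]
  · exact fun j hj => sum_insert_eq_zero (mem_sdiff.1 hj).2
      fun S => symbol t ω S (row (insert j A) f)

theorem sum_pointSymbol_row_erase (t : ℕ) (ω : ℕ → ℕ) (B A : Finset (Fin k)) :
    ∑ j ∈ A, pointSymbol t ω B (row (A.erase j) (X j)) = 0 := by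
  have h := Sq_one_row A (1 : P k)
  simp_rw [mul_one] at h
  rw [← map_sum, ← h, pointSymbol, LinearMap.sum_apply]
  exact sum_eq_zero fun S _ => symbol_eq_zero_of_mem_hit (Sq_mem_hit le_rfl _) t ω S

theorem symbol_mem_of_pointSymbol_mem {t : ℕ} {ω : ℕ → ℕ} {f : P k}
    {T : Submodule (ZMod 2) (P k ⧸ hitLower k (stack (k - 1) t ω))} {S : Finset (Fin k)}
    (h : ∀ B, S ⊆ B → pointSymbol t ω B f ∈ T) : symbol t ω S f ∈ T := by
  induction hn : k - #S using Nat.strong_induction_on generalizing S with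
  | _ n ih =>
    have hS := h S Subset.rfl
    have hmem : S ∈ univ.filter (S ⊆ ·) := by simp
    rw [pointSymbol, LinearMap.sum_apply, ← add_sum_erase _ _ hmem] at hS
    refine (Submodule.add_mem_iff_left T (sum_mem fun S' hS' => ?_)).1 hS
    obtain ⟨hne, hS'⟩ := mem_erase.1 hS'
    have hsub := (mem_filter.1 hS').2
    have hlt := card_lt_card (hsub.ssubset_of_ne (Ne.symm hne))
    have hle := card_le_univ S'
    rw [Fintype.card_fin] at hle
    exact ih (k - #S') (by omega) (fun B hB => h B (hsub.trans hB)) rfl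

end Symbols

/-! ### Spanning -/

section Spanning

variable {k : ℕ}

theorem mem_of_sum_eq_zero {M ι : Type*} [AddCommGroup M] [Module (ZMod 2) M]
    [DecidableEq ι] {T : Submodule (ZMod 2) M} {s : Finset ι} {f : ι → M} {i : ι} (hi : i ∈ s)
    (hs : ∑ j ∈ s, f j = 0) (h : ∀ j ∈ s, j ≠ i → f j ∈ T) : f i ∈ T := by
  rw [← add_sum_erase _ _ hi] at hs
  rw [eq_neg_of_add_eq_zero_left hs]
  exact neg_mem (sum_mem fun j hj => h j (mem_erase.1 hj).2 (mem_erase.1 hj).1)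

/-- The relations at the point with support `B ∋ i` reduce the symbols `U A m` of the monomials
`(∏_{j ∈ A} x_j) x_m²` of weight `(k-3, 1)` to those of the `f_i(z)` with `z ∈ C_k`. -/
theorem mem_of_relations {M : Type*} [AddCommGroup M] [Module (ZMod 2) M]
    {T : Submodule (ZMod 2) M} {B : Finset (Fin k)} {i : Fin k} (hi : i ∈ B)
    (U : Finset (Fin k) → Fin k → M)
    (h1 : ∀ A m, #A + 4 = k → ∑ j ∈ Aᶜ ∩ B, U (insert j A) m = 0)
    (h2 : ∀ A, #A + 2 = k → ∑ j ∈ A, U (A.erase j) j = 0)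
    (hT : ∀ J m, #J = k - 3 → (∃ s ∈ J, s ≤ m) →
      U (J.map ⟨skip i, skip_injective i⟩) (skip i m) ∈ T)
    {A : Finset (Fin k)} (m : Fin k) (hA : #A + 3 = k) : U A m ∈ T := by
  have hred : ∀ m, (∀ A, #A + 3 = k → i ∉ A → U A m ∈ T) → ∀ A, #A + 3 = k → U A m ∈ T := by
    intro m h A hA
    by_cases hiA : i ∈ A
    · have hc := card_erase_add_one hiA
      have := mem_of_sum_eq_zero (T := T) (i := i) (by simp [hi]) (h1 (A.erase i) m (by omega))
        fun j hj hji => h _ ?_ (by simp [Ne.symm hji])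
      · rwa [insert_erase hiA] at this
      · have hjA := mem_compl.1 (mem_inter.1 hj).1
        rw [card_insert_of_notMem hjA]
        omega
    · exact h A hA hiA
  have hne : ∀ m, m ≠ i → ∀ A, #A + 3 = k → i ∉ A → U A m ∈ T := by
    intro m hm A hA hiA
    obtain ⟨m, rfl⟩ := exists_skip_eq hm
    obtain ⟨J, rfl⟩ : ∃ J : Finset (Fin (k - 1)), A = J.map ⟨skip i, skip_injective i⟩ := by
      refine ⟨univ.filter fun s => skip i s ∈ A, ?_⟩
      ext j
      simp only [mem_map, mem_filter, mem_univ, true_and, Function.Embedding.coeFn_mk]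
      constructor
      · intro hj
        obtain ⟨s, rfl⟩ := exists_skip_eq (i := i) (j := j) fun h => hiA (h ▸ hj)
        exact ⟨s, hj, rfl⟩
      · rintro ⟨s, hs, rfl⟩
        exact hs
    rw [card_map] at hA
    by_cases hex : ∃ s ∈ J, s ≤ m
    · exact hT J m (by omega) hex
    · push Not at hex
      have hmJ : m ∉ J := fun h => (hex m h).false
      have hc : #(Jᶜ.erase m) = 1 := by
        rw [card_erase_of_mem (mem_compl.2 hmJ), card_compl, Fintype.card_fin]
        omega
      obtain ⟨b, hb⟩ := card_eq_one.1 hc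
      have hbm : b ≠ m := (mem_erase.1 (hb ▸ mem_singleton_self b)).1
      have hJ : ∀ s, s ∈ J ↔ s ≠ b ∧ s ≠ m := by
        intro s
        have := congrArg (s ∈ ·) hb
        simp only [mem_erase, mem_compl, mem_singleton, eq_iff_iff] at this
        grind
      have hrel := h2 ((univ.erase b).map ⟨skip i, skip_injective i⟩) (by
        rw [card_map, card_erase_univ]
        omega)
      rw [sum_map] at hrel
      simp only [← map_erase] at hrel
      have hJ' : (univ.erase b).erase m = J := by
        ext s
        simp only [mem_erase, mem_univ, and_true, hJ]
        exact and_comm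
      have := mem_of_sum_eq_zero (T := T) (i := m) (by simpa using hbm.symm) hrel ?_
      · rwa [hJ'] at this
      · -- All letters other than `b` and `m` lie in `J`, hence are larger than `m`.
        intro j hj hjm
        have hjb := (mem_erase.1 hj).1
        refine hT _ _ ?_ ⟨m, by simp [hjm.symm, hbm.symm], (hex j ((hJ j).2 ⟨hjb, hjm⟩)).le⟩
        rw [card_erase_of_mem hj, card_erase_univ]
        omega
  refine hred m (fun A hA hiA => ?_) A hA
  by_cases hm : m = i
  · subst hm
    have := mem_of_sum_eq_zero (T := T) (mem_insert_self m A)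
      (h2 (insert m A) (by rw [card_insert_of_notMem hiA]; omega)) fun j hj hjm =>
        hred j (hne j hjm) _ (by rw [card_erase_of_mem hj, card_insert_of_notMem hiA]; omega)
    rwa [erase_insert hiA] at this
  · exact hne m hm A hA hiA

theorem X_eq_monomial_cons (m : Fin k) : (X m : P k) = monomial (Finsupp.single m 1) 1 := rfl

theorem exists_word_of_weight_eq (hk : 3 ≤ k) (t : ℕ) {y : Mon k}
    (hy : (weight y : ℕ → ℕ) = omegaBar k (t + 1)) :
    ∃ l A m, l.length = t ∧ #A + 3 = k ∧ y = wordMon l (cons A (Finsupp.single m 1)) := by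
  have hcons : ∀ {A : Finset (Fin k)} {y : Mon k} {c : ℕ} {ω : ℕ → ℕ},
      (weight (cons A y) : ℕ → ℕ) = consWeight c ω → #A = c ∧ (weight y : ℕ → ℕ) = ω := by
    intro A y c ω h
    rw [weight_cons] at h
    exact ⟨congrFun h 0, funext fun i => congrFun h (i + 1)⟩
  induction t generalizing y with
  | zero =>
    rw [omegaBar_one, ← cons_oddSet_half y] at hy
    obtain ⟨h1, h2⟩ := hcons hy
    rw [← cons_oddSet_half (half y)] at h2
    obtain ⟨h3, h4⟩ := hcons h2
    obtain ⟨m, hm⟩ := card_eq_one.1 h3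
    have h5 : half (half y) = 0 := by
      rw [← Finsupp.degree_eq_zero_iff, degree_eq_deg_weight, WeightVector.deg,
        DFunLike.coe_injective (h4.trans rfl : (weight (half (half y)) : ℕ → ℕ) =
          (0 : WeightVector)), Finsupp.sum_zero_index]
    refine ⟨[], oddSet y, m, rfl, by omega, ?_⟩
    rw [wordMon, ← cons_singleton_zero, ← hm, ← h5, cons_oddSet_half, cons_oddSet_half]
  | succ t ih =>
    rw [omegaBar_add_two, ← cons_oddSet_half y] at hy
    obtain ⟨h1, h2⟩ := hcons hy
    obtain ⟨l, A, m, hl, hA, he⟩ := ih h2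
    obtain ⟨a, ha⟩ := exists_eq_erase (A := oddSet y) (by omega)
    refine ⟨a :: l, A, m, by rw [List.length_cons, hl], hA, ?_⟩
    rw [wordMon, ← he, ← ha, cons_oddSet_half]

/-- The elements `pointSymbol (support n) (f_i z)`, for `n = (i; I)` and `z ∈ C_k`. -/
noncomputable def spanningFamily (k t : ℕ) (a : N k k × HitProblem.C k) :
    P k ⧸ hitLower k (stack (k - 1) t (omegaBar k 1)) :=
  pointSymbol t (omegaBar k 1) (support a.1) (monomial (fMon a.1.1.1 a.2.1) 1)

theorem pointSymbol_mem_span {t : ℕ} (ht : k ≤ t) {B : Finset (Fin k)} (hB : B.Nonempty)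
    {A : Finset (Fin k)} (m : Fin k) (hA : #A + 3 = k) :
    pointSymbol t (omegaBar k 1) B (row A (X m)) ∈
      Submodule.span (ZMod 2) (Set.range (spanningFamily k t)) := by
  have h0 : omegaBar k 1 0 = k - 3 := by rw [omegaBar_one]; rfl
  set i := B.min' hB with hi
  have hiB : i ∈ B := B.min'_mem hB
  have hn : ((i, B.erase i) : Fin k × Finset (Fin k)) ∈ N k k := by
    refine ⟨fun j hj => ?_, ?_⟩
    · obtain ⟨hne, hjB⟩ := mem_erase.1 hj
      exact lt_of_le_of_ne (B.min'_le j hjB) (Ne.symm hne)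
    · have h1 := card_erase_lt_of_mem hiB
      have h2 := card_le_univ B
      rw [Fintype.card_fin] at h2
      exact h1.trans_le h2
  refine mem_of_relations hiB (fun A m => pointSymbol t (omegaBar k 1) B (row A (X m)))
    (fun A m hA => sum_pointSymbol_row ht B (by omega) (X m))
    (fun A _ => sum_pointSymbol_row_erase t _ B A) (fun J m hJ hs => ?_) m hA
  refine Submodule.subset_span ⟨⟨⟨_, hn⟩, ⟨_, cons_single_mem_C_iff.2 ⟨hJ, hs⟩⟩⟩, ?_⟩
  rw [spanningFamily, support, insert_erase hiB, fMon_cons_single, X_eq_monomial_cons,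
    row_monomial]

theorem mkQ_mem_span (hk : 3 ≤ k) {t : ℕ} (ht : k ≤ t) {f : P k}
    (hf : f ∈ PW k (omegaBar k (t + 1))) :
    (hitLower k (stack (k - 1) t (omegaBar k 1))).mkQ f ∈
      Submodule.span (ZMod 2) (Set.range (spanningFamily k t)) := by
  have h : PW k (omegaBar k (t + 1)) ≤ (Submodule.span (ZMod 2)
      (Set.range (spanningFamily k t))).comap
        (hitLower k (stack (k - 1) t (omegaBar k 1))).mkQ := by
    refine Submodule.span_le.2 ?_
    rintro _ ⟨y, -, hy, rfl⟩
    rw [SetLike.mem_coe, Submodule.mem_comap]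
    rcases hy.lt_or_eq with hlt | heq
    · have h0 : (hitLower k (stack (k - 1) t (omegaBar k 1))).mkQ (monomial y 1) = 0 := by
        rw [Submodule.mkQ_apply, Submodule.Quotient.mk_eq_zero, ← omegaBar_eq_stack]
        exact Submodule.mem_sup_right
          (Submodule.subset_span ⟨y, Finsupp.Lex.lt_iff.1 hlt, rfl⟩)
      rw [h0]
      exact zero_mem _
    · obtain ⟨l, A, m, hl, hA, rfl⟩ := exists_word_of_weight_eq hk t
        (congrArg (fun ω : WeightVector => (ω : ℕ → ℕ)) (toLex_inj.1 heq))
      have hne : l.toFinset.Nonempty := by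
        rw [List.toFinset_nonempty_iff]
        rintro rfl
        rw [List.length_nil] at hl
        omega
      rw [← word_monomial, ← row_monomial, ← X_eq_monomial_cons, ← symbol_toFinset hl]
      exact symbol_mem_of_pointSymbol_mem fun B hB =>
        pointSymbol_mem_span ht (hne.mono hB) m hA
  exact h hf

end Spanning

/-! ### Homogeneity of the hit polynomials -/

section Homogeneity

variable {k : ℕ}

theorem sqfree_isHomogeneous (A : Finset (Fin k)) : (sqfree A).IsHomogeneous #A := by
  rw [sqfree, card_eq_sum_ones]
  exact IsHomogeneous.prod _ _ _ fun j _ => isHomogeneous_X _ _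

theorem row_isHomogeneous (A : Finset (Fin k)) {f : P k} {n : ℕ} (hf : f.IsHomogeneous n) :
    (row A f).IsHomogeneous (#A + n * 2) := by
  rw [row_apply]
  exact (sqfree_isHomogeneous A).mul (hf.pow 2)

theorem Sq_monomial_isHomogeneous (i : ℕ) (y : Mon k) :
    (Sq k i (monomial y 1)).IsHomogeneous (y.degree + i) := by
  induction h : y.degree using Nat.strong_induction_on generalizing y i with
  | _ n ih =>
    subst h
    by_cases h0 : y = 0
    · subst h0
      have h1 : (monomial 0 1 : P k) = 1 := rfl
      rw [h1, Sq_apply, map_one, Polynomial.coeff_one]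
      split_ifs with hi
      · subst hi
        simpa using isHomogeneous_one (Fin k) (ZMod 2)
      · exact isHomogeneous_zero _ _ _
    · have h1 : y.degree = #(oddSet y) + 2 * (half y).degree := by
        rw [← degree_cons, cons_oddSet_half]
      have h2 : y.degree ≠ 0 := by rwa [Ne, Finsupp.degree_eq_zero_iff]
      rw [monomial_eq_row, Sq_row]
      refine IsHomogeneous.sum _ _ _ fun B hB => ?_
      split_ifs with hc
      · obtain ⟨c, he⟩ := hc.2
        have h3 := row_isHomogeneous (oddSet y \ B) ((sqfree_isHomogeneous B).mul
          (ih (half y).degree (by omega) ((i - #B) / 2) (half y) rfl))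
        convert h3 using 1
        have h4 := card_sdiff_add_card_eq_card (mem_powerset.1 hB)
        have h5 := hc.1
        omega
      · exact isHomogeneous_zero _ _ _

theorem homogeneousComponent_mem_hit (n : ℕ) {f : P k} (hf : f ∈ hit k) :
    homogeneousComponent n f ∈ hit k := by
  have h : hit k ≤ (hit k).comap ((homogeneousComponent n).restrictScalars (ZMod 2)) := by
    refine hit_le fun i hi g => ?_
    rw [Submodule.mem_comap, LinearMap.restrictScalars_apply]
    induction g using monomial_induction with
    | zero => simp
    | monomial y =>
      rw [homogeneousComponent_of_mem (Sq_monomial_isHomogeneous i y)]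
      split_ifs
      · exact Sq_mem_hit hi _
      · exact zero_mem _
    | add f g hf hg => rw [map_add, map_add]; exact add_mem hf hg
  exact h hf

theorem homogeneousComponent_monomial (n : ℕ) (y : Mon k) :
    homogeneousComponent n (monomial y 1 : P k) = if n = y.degree then monomial y 1 else 0 :=
  homogeneousComponent_of_mem (isHomogeneous_monomial 1 rfl)

theorem homogeneousComponent_of_mem_PW {ω : WeightVector} {f : P k} (hf : f ∈ PW k ω) :
    homogeneousComponent ω.deg f = f := by
  induction hf using Submodule.span_induction with
  | mem f hf =>
    obtain ⟨y, hy, -, rfl⟩ := hf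
    rw [homogeneousComponent_monomial, if_pos hy.symm]
  | zero => simp
  | add f g _ _ hf hg => rw [map_add, hf, hg]
  | smul c f _ hf =>
    have := map_smul ((homogeneousComponent ω.deg).restrictScalars (ZMod 2)) c f
    simp only [LinearMap.restrictScalars_apply] at this
    rw [this, hf]

theorem homogeneousComponent_mem_PWminus {ω : WeightVector} {f : P k} (hf : f ∈ lower k ω) :
    homogeneousComponent ω.deg f ∈ PWminus k ω := by
  have h : lower k ω ≤ (PWminus k ω).comap
      ((homogeneousComponent ω.deg).restrictScalars (ZMod 2)) := by
    refine Submodule.span_le.2 ?_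
    rintro _ ⟨y, hy, rfl⟩
    rw [SetLike.mem_coe, Submodule.mem_comap, LinearMap.restrictScalars_apply,
      homogeneousComponent_monomial]
    split_ifs with h
    · exact Submodule.subset_span ⟨y, h.symm, Finsupp.Lex.lt_iff.2 hy, rfl⟩
    · exact zero_mem _
  exact h hf

theorem PWminus_le_PW (ω : WeightVector) : PWminus k ω ≤ PW k ω := by
  refine Submodule.span_mono ?_
  rintro _ ⟨y, h, hy, rfl⟩
  exact ⟨y, h, hy.le, rfl⟩

/-- A polynomial of `P_k(ω)` that is hit modulo monomials of lower weight, of whatever degree,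
represents `0` in `QP_k(ω)`: take homogeneous components of degree `deg ω`. -/
theorem mem_sup_of_mem_hitLower {ω : WeightVector} {f : P k} (hf : f ∈ PW k ω)
    (h : f ∈ hitLower k ω) : f ∈ (hit k ⊓ PW k ω) ⊔ PWminus k ω := by
  obtain ⟨g, hg, e, he, rfl⟩ := Submodule.mem_sup.1 h
  have h1 := homogeneousComponent_of_mem_PW hf
  have h2 := homogeneousComponent_mem_PWminus he
  have h3 := homogeneousComponent_mem_hit ω.deg hg
  rw [map_add] at h1
  rw [← h1] at hf ⊢
  refine Submodule.add_mem_sup ⟨h3, ?_⟩ h2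
  exact (Submodule.add_mem_iff_left _ (PWminus_le_PW ω h2)).1 hf

instance finite_PW (ω : WeightVector) : Module.Finite (ZMod 2) (PW k ω) := by
  refine FiniteDimensional.span_of_finite _ (((Finsupp.finite_of_degree_le ω.deg).image
    fun y : Mon k => (monomial y 1 : P k)).subset ?_)
  rintro _ ⟨y, hy, -, rfl⟩
  exact ⟨y, hy.le, rfl⟩

end Homogeneity

/-! ### Counting -/

section Counting

variable {k : ℕ}

theorem card_N (k q : ℕ) : Nat.card (N k q) = ∑ u ∈ Icc 1 q, k.choose u := by
  have himage : Set.range (support : N k q → Finset (Fin k)) =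
      (univ.filter fun S : Finset (Fin k) => 1 ≤ #S ∧ #S ≤ q : Finset (Finset (Fin k))) := by
    ext S
    simp only [Set.mem_range, coe_filter, mem_univ, true_and, Set.mem_ofPred_eq]
    constructor
    · rintro ⟨n, rfl⟩
      rw [support, card_insert_of_notMem fun h => (n.2.1 _ h).false]
      exact ⟨by omega, n.2.2⟩
    · rintro ⟨h1, h2⟩
      have hS : S.Nonempty := card_pos.1 h1
      have hmem := S.min'_mem hS
      refine ⟨⟨(S.min' hS, S.erase (S.min' hS)), fun j hj => ?_, ?_⟩, insert_erase hmem⟩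
      · obtain ⟨hne, hjS⟩ := mem_erase.1 hj
        exact lt_of_le_of_ne (S.min'_le j hjS) (Ne.symm hne)
      · exact (card_erase_lt_of_mem hmem).trans_le h2
  rw [← Nat.card_range_of_injective support_injective, himage, Nat.card_coe_set_eq,
    Set.ncard_coe_finset, card_eq_sum_card_fiberwise (f := card) (t := Icc 1 q)]
  · refine sum_congr rfl fun u hu => ?_
    have h : (univ.filter fun S : Finset (Fin k) => 1 ≤ #S ∧ #S ≤ q).filter (fun S => #S = u) =
        powersetCard u univ := by
      ext S
      simp only [mem_filter, mem_univ, true_and, mem_powersetCard, subset_univ]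
      rw [mem_Icc] at hu
      omega
    rw [h, card_powersetCard, card_univ, Fintype.card_fin]
  · intro S hS
    simpa using hS

/-- The pairs `(J, m)` with `(∏_{j ∈ J} x_j) x_m² ∈ C_k`. -/
def pairsC (k : ℕ) : Finset (Finset (Fin (k - 1)) × Fin (k - 1)) :=
  (powersetCard (k - 3) univ ×ˢ univ).filter fun p => ∃ s ∈ p.1, s ≤ p.2

theorem C_eq_image (k : ℕ) : HitProblem.C k =
    (fun p : Finset (Fin (k - 1)) × Fin (k - 1) => cons p.1 (Finsupp.single p.2 1)) ''
      pairsC k := by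
  ext z
  rw [mem_C_iff]
  simp only [pairsC, coe_filter, mem_product, mem_powersetCard, subset_univ, true_and, mem_univ,
    and_true, Set.mem_image, Set.mem_ofPred_eq, Prod.exists]
  constructor
  · rintro ⟨J, m, h1, h2, rfl⟩
    exact ⟨J, m, ⟨h1, h2⟩, rfl⟩
  · rintro ⟨J, m, ⟨h1, h2⟩, rfl⟩
    exact ⟨J, m, h1, h2, rfl⟩

theorem card_compl_pairsC (hk : 3 ≤ k) :
    #((powersetCard (k - 3) univ ×ˢ univ).filter
      fun p : Finset (Fin (k - 1)) × Fin (k - 1) => ¬ ∃ s ∈ p.1, s ≤ p.2) = k - 1 := by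
  -- For each `b` there is exactly one such pair with `J` the complement of `{b, m}`.
  let pivot : Fin (k - 1) → Fin (k - 1) := fun b => if b.1 = 0 then ⟨1, by omega⟩ else ⟨0, by omega⟩
  have hp0 : ∀ b, b.1 = 0 → (pivot b).1 = 1 := fun b h => by simp [pivot, h]
  have hp1 : ∀ b, b.1 ≠ 0 → (pivot b).1 = 0 := fun b h => by simp [pivot, h]
  have hpb : ∀ b, b ≠ pivot b := by
    intro b h
    by_cases h0 : b.1 = 0
    · have := hp0 b h0
      rw [← h] at this
      omega
    · have := hp1 b h0
      rw [← h] at this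
      omega
  have himage : (powersetCard (k - 3) univ ×ˢ univ).filter
      (fun p : Finset (Fin (k - 1)) × Fin (k - 1) => ¬ ∃ s ∈ p.1, s ≤ p.2) =
      univ.image fun b => (({b, pivot b} : Finset (Fin (k - 1)))ᶜ, pivot b) := by
    ext ⟨J, m⟩
    simp only [mem_filter, mem_product, mem_powersetCard, subset_univ, true_and, mem_univ,
      and_true, mem_image, Prod.mk.injEq]
    constructor
    · rintro ⟨hJ, hs⟩
      push Not at hs
      have hmJ : m ∉ J := fun h => (hs m h).false
      have hc : #(Jᶜ.erase m) = 1 := by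
        rw [card_erase_of_mem (mem_compl.2 hmJ), card_compl, Fintype.card_fin]
        omega
      obtain ⟨b, hb⟩ := card_eq_one.1 hc
      have hmem : ∀ s, s ∉ J ↔ s = b ∨ s = m := by
        intro s
        have := congrArg (s ∈ ·) hb
        simp only [mem_erase, mem_compl, mem_singleton, eq_iff_iff] at this
        grind
      have hbm : b ≠ m := (mem_erase.1 (hb ▸ mem_singleton_self b)).1
      have hlt : ∀ s : Fin (k - 1), s.1 < m.1 → s = b := fun s hsm => by
        refine ((hmem s).1 fun h => ?_).resolve_right fun h => ?_
        · have := Fin.lt_def.1 (hs s h)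
          omega
        · rw [h] at hsm
          exact hsm.false
      have hm : pivot b = m := by
        have hbm' : b.1 ≠ m.1 := fun h => hbm (Fin.ext h)
        ext
        by_cases h0 : b.1 = 0
        · rw [hp0 b h0]
          by_contra hne
          have := congrArg Fin.val (hlt ⟨1, by omega⟩ (by simp only; omega))
          simp only at this
          omega
        · rw [hp1 b h0]
          by_contra hne
          have := congrArg Fin.val (hlt ⟨0, by omega⟩ (by simp only; omega))
          simp only at this
          omega
      refine ⟨b, ?_, hm⟩
      rw [hm]
      ext s
      have := hmem s
      simp only [mem_compl, mem_insert, mem_singleton]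
      grind
    · rintro ⟨b, rfl, rfl⟩
      refine ⟨?_, ?_⟩
      · rw [card_compl, card_pair (hpb b), Fintype.card_fin]
        omega
      · rintro ⟨s, hs, hle⟩
        simp only [mem_compl, mem_insert, mem_singleton, not_or, Fin.ext_iff] at hs
        rw [Fin.le_def] at hle
        by_cases h0 : b.1 = 0
        · have := hp0 b h0
          omega
        · have := hp1 b h0
          omega
  rw [himage, card_image_of_injective, card_univ, Fintype.card_fin]
  intro b b' h
  obtain ⟨h1, h2⟩ := Prod.mk.inj h
  have hb : b ∈ ({b', pivot b'} : Finset (Fin (k - 1))) := by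
    rw [← compl_injective h1]
    exact mem_insert_self _ _
  rw [mem_insert, mem_singleton] at hb
  exact hb.resolve_right fun h => hpb b (h.trans h2.symm)

theorem card_C (hk : 3 ≤ k) : Nat.card (HitProblem.C k) = (k - 3) * k.choose 2 := by
  have hinj : Function.Injective fun p : Finset (Fin (k - 1)) × Fin (k - 1) =>
      cons p.1 (Finsupp.single p.2 1) := by
    rintro ⟨J, m⟩ ⟨J', m'⟩ h
    obtain ⟨h1, h2⟩ := cons_injective h
    exact Prod.ext h1 ((Finsupp.single_left_inj one_ne_zero).1 h2)
  rw [C_eq_image, Nat.card_image_of_injective hinj, Nat.card_coe_set_eq, Set.ncard_coe_finset]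
  have h := card_filter_add_card_filter_not (s := powersetCard (k - 3) univ ×ˢ univ)
    fun p : Finset (Fin (k - 1)) × Fin (k - 1) => ∃ s ∈ p.1, s ≤ p.2
  rw [card_compl_pairsC hk, card_product, card_powersetCard, card_univ, Fintype.card_fin] at h
  obtain ⟨r, rfl⟩ := Nat.exists_eq_add_of_le' hk
  have h1 : (r + 2).choose 2 * 2 = (r + 2) * (r + 1) := by
    rw [Nat.choose_two_right]
    exact Nat.div_mul_cancel (Nat.two_dvd_mul_sub_one (r + 2))
  have h2 : (r + 3).choose 2 = (r + 2) + (r + 2).choose 2 := by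
    rw [Nat.choose_succ_succ' (r + 2) 1, Nat.choose_one_right]
  have h3 : (r + 2).choose r = (r + 2).choose 2 := Nat.choose_symm_add
  change #(pairsC (r + 3)) + (r + 2) = (r + 2).choose r * (r + 2) at h
  rw [h3] at h
  rw [h2, Nat.add_sub_cancel]
  linarith

instance finite_C : Finite (HitProblem.C k) := by
  rw [C_eq_image]
  exact ((pairsC k).finite_toSet.image _).to_subtype

end Counting

/-! ### The dimension of `QP_k(ω̄)` -/

section Dimension

variable {k : ℕ}

theorem finrank_QP_le (hk : 3 ≤ k) {t : ℕ} (ht : k ≤ t) :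
    Module.finrank (ZMod 2) (QP k (omegaBar k (t + 1))) ≤
      Nat.card (N k k × HitProblem.C k) := by
  have := Fintype.ofFinite (N k k × HitProblem.C k)
  set V := Submodule.span (ZMod 2) (Set.range (spanningFamily k t))
  let φ : PW k (omegaBar k (t + 1)) →ₗ[ZMod 2] V :=
    ((hitLower k (stack (k - 1) t (omegaBar k 1))).mkQ.comp (PW k _).subtype).codRestrict V
      fun f => mkQ_mem_span hk ht f.2
  have hker : ∀ f, φ f = 0 → f ∈ ((hit k ⊓ PW k (omegaBar k (t + 1))) ⊔
      PWminus k (omegaBar k (t + 1))).comap (PW k _).subtype := by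
    intro f hf
    have h := congrArg Subtype.val hf
    refine mem_sup_of_mem_hitLower f.2 ?_
    rw [omegaBar_eq_stack]
    exact (Submodule.Quotient.mk_eq_zero _).1 h
  -- `QP_k(ω̄)` is a quotient of `PW / ker φ`, which embeds into the span.
  have h1 : Module.finrank (ZMod 2) (QP k (omegaBar k (t + 1))) ≤
      Module.finrank (ZMod 2) (PW k (omegaBar k (t + 1)) ⧸ LinearMap.ker φ) := by
    have hsurj : Function.Surjective (Submodule.factor fun f hf => hker f (LinearMap.mem_ker.1 hf) :
        (PW k (omegaBar k (t + 1)) ⧸ LinearMap.ker φ) →ₗ[ZMod 2] QP k (omegaBar k (t + 1))) :=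
      Submodule.factor_surjective _
    exact LinearMap.finrank_le_finrank_of_surjective hsurj
  have hfin : Module.Finite (ZMod 2) V := FiniteDimensional.span_of_finite _ (Set.finite_range _)
  have h2 : Module.finrank (ZMod 2) (PW k (omegaBar k (t + 1)) ⧸ LinearMap.ker φ) ≤
      Module.finrank (ZMod 2) V := by
    rw [φ.quotKerEquivRange.finrank_eq]
    exact Submodule.finrank_le _
  rw [Nat.card_eq_fintype_card]
  exact h1.trans (h2.trans (finrank_range_le_card (R := ZMod 2) (spanningFamily k t)))

end Dimension

end HitProblem

theorem mainTheorem3 (k d q : ℕ) (hk : 3 ≤ k) (hd : 1 ≤ d) (hq : q = min k (d - 1)) :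
    ∃ hmem : ∀ a : HitProblem.N k q × HitProblem.C k,
        HitProblem.gen k d q a ∈ HitProblem.PW k (HitProblem.omegaBar k d),
      LinearIndependent (ZMod 2)
        (fun a : HitProblem.N k q × HitProblem.C k =>
          HitProblem.cls (HitProblem.gen k d q a) (hmem a)) ∧
      (k < d →
        ∃ b : Module.Basis (HitProblem.N k q × HitProblem.C k) (ZMod 2)
            (HitProblem.QP k (HitProblem.omegaBar k d)),
          ∀ a, b a = HitProblem.cls (HitProblem.gen k d q a) (hmem a)) ∧
      Module.Finite (ZMod 2) (HitProblem.QP k (HitProblem.omegaBar k d)) ∧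
      (k - 3) * k.choose 2 * ∑ u ∈ Finset.Icc 1 q, k.choose u ≤
        Module.finrank (ZMod 2) (HitProblem.QP k (HitProblem.omegaBar k d)) ∧
      (k < d →
        Module.finrank (ZMod 2) (HitProblem.QP k (HitProblem.omegaBar k d)) =
          (k - 3) * k.choose 2 * ∑ u ∈ Finset.Icc 1 q, k.choose u) := by
  obtain ⟨t, rfl⟩ := Nat.exists_eq_add_of_le' hd
  rw [Nat.add_sub_cancel] at hq
  have hqt : q ≤ t := hq ▸ min_le_right _ _
  have hmem : ∀ a : HitProblem.N k q × HitProblem.C k,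
      HitProblem.gen k (t + 1) q a ∈ HitProblem.PW k (HitProblem.omegaBar k (t + 1)) :=
    HitProblem.gen_mem_PW hd (by simpa using hqt)
  have hli := HitProblem.linearIndependent_cls_gen hk hqt hmem
  have hcard : Nat.card (HitProblem.N k q × HitProblem.C k) =
      (k - 3) * k.choose 2 * ∑ u ∈ Finset.Icc 1 q, k.choose u := by
    rw [Nat.card_prod, HitProblem.card_N, HitProblem.card_C hk, mul_comm]
  have := Fintype.ofFinite (HitProblem.N k q × HitProblem.C k)
  have hge : (k - 3) * k.choose 2 * ∑ u ∈ Finset.Icc 1 q, k.choose u ≤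
      Module.finrank (ZMod 2) (HitProblem.QP k (HitProblem.omegaBar k (t + 1))) := by
    rw [← hcard, Nat.card_eq_fintype_card]
    exact hli.fintype_card_le_finrank
  have heq : k < t + 1 →
      Module.finrank (ZMod 2) (HitProblem.QP k (HitProblem.omegaBar k (t + 1))) =
        (k - 3) * k.choose 2 * ∑ u ∈ Finset.Icc 1 q, k.choose u := by
    intro hkt
    have hqk : q = k := by omega
    refine le_antisymm ?_ hge
    rw [← hcard, hqk]
    exact HitProblem.finrank_QP_le hk (by omega)
  refine ⟨hmem, hli, fun hkt => ?_, inferInstance, hge, heq⟩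
  have hspan := hli.span_eq_top_of_card_eq_finrank'
    (by rw [heq hkt, ← hcard, Nat.card_eq_fintype_card])
  exact ⟨Module.Basis.mk hli hspan.ge, fun a => Module.Basis.mk_apply hli hspan.ge a⟩
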